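/- **Setting.** Let $\mathcal K$ be a Markov kernel on $\mathbb R^d$ realized through a driving noise: there are a probability measure $\nu$ on a measurable space $\Xi$ and a measurable map $F:\mathbb R^d\times\Xi\to\mathbb R^d$ such that $F(a,\xi)\sim\mathcal K(a,\cdot)$ for every $a\in\mathbb R^d$ when $\xi\sim\nu$. Let $H\in\mathbb R^{m\times d}$, let $\Gamma\in\mathbb R^{m\times m}$ be symmetric positive definite, and let $\rho_0$ be a probability measure on $\mathbb R^d$. Assume: (i) there is a constant $C$ such that for all $a,b\in\mathbb R^d$ one has $|F(a,\xi)-F(b,\xi)|\le C|a-b|$ for $\nu$-almost every $\xi$; (ii) for every real $p\ge 2$ there is a constant $C'=C'_p$ such that $\int |v|^p\,(\mu\mathcal K)(dv)\le C'\bigl(1+\int|u|^p\mu(du)\bigr)$ for every probability measure $\mu$ on $\mathbb R^d$ with finite $p$-th moment, where $\mu\mathcal K=\int\mu(du)\,\mathcal K(u,\cdot)$; (iii) $\int|u|^p\,\rho_0(du)<\infty$ for every $p\ge 2$. **Mean-field EnKF.** Given data $y=(y_1,y_2,\dots)$ in $\mathbb R^m$, put $\pi_{t_0}=\rho_0$.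 Given $\pi_{t_j}$, let $\hat v\sim\pi_{t_j}\mathcal K$, let $\hat C$ be the covariance matrix of $\hat v$, let $G=\hat CH^\top(H\hat CH^\top+\Gamma)^{-1}$, and let $\pi_{t_{j+1}}$ be the law of $(I-GH)\hat v+G(y_{j+1}+\tilde\eta)$, where $\tilde\eta\sim N(0,\Gamma)$ is independent of $\hat v$. **Perturbed-observation EnKF.** Let $N\ge1$. Let $v_0^{(n)}\sim\rho_0$, $\xi_j^{(n)}\sim\nu$, $\tilde\eta_j^{(n)}\sim N(0,\Gamma)$ ($1\le n\le N$, $j\ge1$) be mutually independent. Set $\hat v_{j+1}^{(n)}=F(v_j^{(n)},\xi_{j+1}^{(n)})$, $\hat m_{j+1}=\frac1N\sum_n\hat v^{(n)}_{j+1}$, $\hat C_{j+1}=\frac1N\sum_n(\hat v^{(n)}_{j+1}-\hat m_{j+1})(\hat v^{(n)}_{j+1}-\hat m_{j+1})^\top$, $K_{j+1}=\hat C_{j+1}H^\top(H\hat C_{j+1}H^\top+\Gamma)^{-1}$ and $v_{j+1}^{(n)}=(I-K_{j+1}H)\hat v_{j+1}^{(n)}+K_{j+1}(y_{j+1}+\tilde\eta_{j+1}^{(n)})$.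 Let $\hat\pi^N_{t_j}=\frac1N\sum_{n=1}^N\delta_{v_j^{(n)}}$. **Distance.** For random probability measures $\mu,\mu'$ on $\mathbb R^d$, $$d(\mu,\mu')=\sup_{|f|_L\le1}\sqrt{\mathbb E\Bigl|\int f\,d\mu-\int f\,d\mu'\Bigr|^2},\qquad |f|_L=\sup_x|f(x)|+\sup_{x\ne x'}\frac{|f(x)-f(x')|}{|x-x'|},$$ the supremum being over functions $f:\mathbb R^d\to\mathbb R$. **Theorem.** Under (i)–(iii), for every $j\ge0$, $$d(\hat\pi^N_{t_j},\pi_{t_j})=\mathcal O(N^{-1/2}),$$ that is, there is a constant $c$ independent of $N$ with $d(\hat\pi^N_{t_j},\pi_{t_j})\le cN^{-1/2}$ for all $N\ge1$. This holds in both of the following readings: (a) the data are random and generated by the model, $y_j=Hu_j+\eta_j$, where $u_0\sim\rho_0$ and $u_{j+1}=F(u_j,\xi_{j+1})$ with $\xi_j\sim\nu$ and $\eta_j\sim N(0,\Gamma)$, all of these variables being mutually independent and independent of the variables that drive the ensemble, and the expectation in $d$ is over the data and the ensemble; (b) the data $y$ are an arbitrary fixed sequence, the expectation in $d$ is over the ensemble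 only, and $c$ may depend on $y$. -/

import Mathlib

open MeasureTheory ProbabilityTheory
open scoped ENNReal NNReal Matrix

namespace EnKF

noncomputable section

/-- `ℝⁿ` with its Euclidean norm. -/
abbrev Euc (n : ℕ) : Type := EuclideanSpace ℝ (Fin n)

/-! ### The distance between random measures -/

/-- The bounded Lipschitz norm
`|f|_L = sup_x |f x| + sup_{x ≠ x'} |f x - f x'| / |x - x'|`, with values in `[0, ∞]`. -/
def blNorm {E : Type*} [PseudoEMetricSpace E] (f : E → ℝ) : ℝ≥0∞ :=
  (⨆ x, ‖f x‖ₑ) + ⨆ (x) (x') (_ : x ≠ x'), ‖f x - f x'‖ₑ / edist x x'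

/-- The root-mean-square bounded Lipschitz distance between two random measures `μ` and `ν`
defined on a probability space `(Ω, P)`:
`sup_{|f|_L ≤ 1} (𝔼 |∫ f dμ - ∫ f dν|²)^{1/2}`. -/
def rmsDist {Ω E : Type*} [MeasurableSpace Ω] [PseudoEMetricSpace E] [MeasurableSpace E]
    (P : Measure Ω) (μ ν : Ω → Measure E) : ℝ≥0∞ :=
  ⨆ (f : E → ℝ) (_ : blNorm f ≤ 1),
    (∫⁻ ω, ‖(∫ x, f x ∂(μ ω)) - ∫ x, f x ∂(ν ω)‖ₑ ^ 2 ∂P) ^ (1 / 2 : ℝ)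

/-- The empirical measure `N⁻¹ ∑ₙ δ_{v n}` of an ensemble. -/
def empirical {E : Type*} [MeasurableSpace E] {N : ℕ} (v : Fin N → E) : Measure E :=
  (N : ℝ≥0∞)⁻¹ • ∑ n, Measure.dirac (v n)

/-! ### The state-space model -/

/-- A realization of a Markov kernel `K` on `ℝᵈ` through a driving noise `ξ ∈ Ξ` of law `law`:
`step a ξ ∼ K(a, ·)` for every `a`. Evaluating `step a` and `step b` at the same `ξ` gives draws
from `K(a, ·)` and `K(b, ·)` under the same realization of the noise. -/
structure DrivingNoise {d : ℕ} (K : Kernel (Euc d) (Euc d)) (Ξ : Type*) [MeasurableSpace Ξ] where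
  /-- The law of the driving noise. -/
  law : Measure Ξ
  isProbabilityMeasure_law : IsProbabilityMeasure law
  /-- One step of the dynamics with a given noise. -/
  step : Euc d → Ξ → Euc d
  measurable_step : Measurable (Function.uncurry step)
  map_step : ∀ a, law.map (step a) = K a

/-- The signal `u_{j+1} = step u_j w_{j+1}`, started at `u₀`. -/
def signal {d : ℕ} {Ξ : Type*} (step : Euc d → Ξ → Euc d) (u₀ : Euc d) (w : ℕ → Ξ) : ℕ → Euc d
  | 0 => u₀
  | j + 1 => step (signal step u₀ w j) (w (j + 1))

/-- The observation `H u + η`. -/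
def observe {d m : ℕ} (H : Matrix (Fin m) (Fin d) ℝ) (u : Euc d) (η : Euc m) : Euc m :=
  WithLp.toLp 2 (H *ᵥ u.ofLp) + η

/-! ### The Kalman update -/

/-- The Kalman gain `C Hᵀ (H C Hᵀ + Γ)⁻¹` for the forecast covariance `C`. -/
def gain {d m : ℕ} (H : Matrix (Fin m) (Fin d) ℝ) (Γ : Matrix (Fin m) (Fin m) ℝ)
    (C : Matrix (Fin d) (Fin d) ℝ) : Matrix (Fin d) (Fin m) ℝ :=
  C * Hᵀ * (H * C * Hᵀ + Γ)⁻¹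

/-- The update `(I - G H) x + G z` of a forecast `x` by a (perturbed) observation `z`,
with gain `G`. -/
def update {d m : ℕ} (H : Matrix (Fin m) (Fin d) ℝ) (G : Matrix (Fin d) (Fin m) ℝ)
    (x : Euc d) (z : Euc m) : Euc d :=
  WithLp.toLp 2 ((1 - G * H) *ᵥ x.ofLp + G *ᵥ z.ofLp)

/-! ### The mean-field EnKF -/

/-- The covariance matrix of a measure on `ℝᵈ`. -/
def covMatrix {d : ℕ} (π : Measure (Euc d)) : Matrix (Fin d) (Fin d) ℝ :=
  Matrix.of fun i k => cov[fun v => v i, fun v => v k; π]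

/-- The mean-field update of the forecast law `π` by the observation `y`: the law of
`(I - G H) v + G (y + η)` for independent `v ∼ π` and `η ∼ N(0, Γ)`, where `G` is the Kalman gain
of the covariance matrix of `π`. -/
def meanFieldUpdate {d m : ℕ} (H : Matrix (Fin m) (Fin d) ℝ) (Γ : Matrix (Fin m) (Fin m) ℝ)
    (y : Euc m) (π : Measure (Euc d)) : Measure (Euc d) :=
  (π.prod (multivariateGaussian 0 Γ)).map
    fun p => update H (gain H Γ (covMatrix π)) p.1 (y + p.2)

/-- The law `π_j` of the mean-field EnKF after assimilation of the data `y_1, …, y_j`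
(the value `y 0` is not used). -/
def meanField {d m : ℕ} (K : Kernel (Euc d) (Euc d)) (H : Matrix (Fin m) (Fin d) ℝ)
    (Γ : Matrix (Fin m) (Fin m) ℝ) (ρ₀ : Measure (Euc d)) (y : ℕ → Euc m) : ℕ → Measure (Euc d)
  | 0 => ρ₀
  | j + 1 => meanFieldUpdate H Γ (y (j + 1)) ((meanField K H Γ ρ₀ y j).bind K)

/-! ### The finite-ensemble EnKF -/

/-- The sample mean. -/
def sampleMean {d N : ℕ} (v : Fin N → Euc d) : Euc d :=
  (N : ℝ)⁻¹ • ∑ n, v n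

/-- The sample covariance matrix, normalized by `N⁻¹`. -/
def sampleCov {d N : ℕ} (v : Fin N → Euc d) : Matrix (Fin d) (Fin d) ℝ :=
  (N : ℝ)⁻¹ • ∑ n, Matrix.vecMulVec (v n - sampleMean v).ofLp (v n - sampleMean v).ofLp

/-- The perturbed-observation EnKF with `N` members: initial ensemble `v₀`, driving noises `w j n`
and observation perturbations `η j n` of member `n` at step `j ≥ 1`, data `y_1, y_2, …`. -/
def ensemble {d m N : ℕ} {Ξ : Type*} (step : Euc d → Ξ → Euc d) (H : Matrix (Fin m) (Fin d) ℝ)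
    (Γ : Matrix (Fin m) (Fin m) ℝ) (y : ℕ → Euc m) (v₀ : Fin N → Euc d) (w : ℕ → Fin N → Ξ)
    (η : ℕ → Fin N → Euc m) : ℕ → Fin N → Euc d
  | 0 => v₀
  | j + 1 =>
    let forecast : Fin N → Euc d := fun n => step (ensemble step H Γ y v₀ w η j n) (w (j + 1) n)
    fun n => update H (gain H Γ (sampleCov forecast)) (forecast n) (y (j + 1) + η (j + 1) n)

/-! ### The randomness -/

/-- Labels of the sources of randomness: those of the signal and of its observation,
and those of the ensemble members. -/
inductive Source : Type
  | signalInit : Source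
  | signalNoise (j : ℕ) : Source
  | obsNoise (j : ℕ) : Source
  | memberInit (n : ℕ) : Source
  | memberNoise (j n : ℕ) : Source
  | memberPert (j n : ℕ) : Source

/-- The random variables, on a probability space `(Ω, P)`, that generate the signal, the
observations and the ensembles: all initial states have law `ρ₀`, all driving noises have law `ν`,
all observation noises and perturbations have law `N(0, Γ)`, and all of them are mutually
independent. The `N`-member EnKF uses the members `n < N`; only steps `j ≥ 1` are used. -/
structure Randomness {Ω : Type*} [MeasurableSpace Ω] (P : Measure Ω) {d m : ℕ}
    (ρ₀ : Measure (Euc d)) {Ξ : Type*} [MeasurableSpace Ξ] (ν : Measure Ξ)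
    (Γ : Matrix (Fin m) (Fin m) ℝ) where
  /-- Initial state of the signal. -/
  u₀ : Ω → Euc d
  /-- Driving noise of the signal. -/
  ξ : ℕ → Ω → Ξ
  /-- Observation noise. -/
  η : ℕ → Ω → Euc m
  /-- Initial states of the ensemble members. -/
  v₀ : ℕ → Ω → Euc d
  /-- Driving noises of the ensemble members (step, member). -/
  w : ℕ → ℕ → Ω → Ξ
  /-- Perturbations of the observations (step, member). -/
  ηt : ℕ → ℕ → Ω → Euc m
  measurable_u₀ : Measurable u₀
  measurable_ξ : ∀ j, Measurable (ξ j)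
  measurable_η : ∀ j, Measurable (η j)
  measurable_v₀ : ∀ n, Measurable (v₀ n)
  measurable_w : ∀ j n, Measurable (w j n)
  measurable_ηt : ∀ j n, Measurable (ηt j n)
  map_u₀ : P.map u₀ = ρ₀
  map_ξ : ∀ j, P.map (ξ j) = ν
  map_η : ∀ j, P.map (η j) = multivariateGaussian 0 Γ
  map_v₀ : ∀ n, P.map (v₀ n) = ρ₀
  map_w : ∀ j n, P.map (w j n) = ν
  map_ηt : ∀ j n, P.map (ηt j n) = multivariateGaussian 0 Γ
  indep : iIndep
    (fun s : Source => match s with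
      | .signalInit => MeasurableSpace.comap u₀ inferInstance
      | .signalNoise j => MeasurableSpace.comap (ξ j) inferInstance
      | .obsNoise j => MeasurableSpace.comap (η j) inferInstance
      | .memberInit n => MeasurableSpace.comap (v₀ n) inferInstance
      | .memberNoise j n => MeasurableSpace.comap (w j n) inferInstance
      | .memberPert j n => MeasurableSpace.comap (ηt j n) inferInstance) P

namespace Randomness

variable {Ω : Type*} [MeasurableSpace Ω] {P : Measure Ω} {d m : ℕ} {ρ₀ : Measure (Euc d)}
  {Ξ : Type*} [MeasurableSpace Ξ] {ν : Measure Ξ} {Γ : Matrix (Fin m) (Fin m) ℝ}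

/-- The data `y_j = H u_j + η_j` generated by the state-space model. -/
def data (R : Randomness P ρ₀ ν Γ) (step : Euc d → Ξ → Euc d) (H : Matrix (Fin m) (Fin d) ℝ)
    (ω : Ω) (j : ℕ) : Euc m :=
  observe H (signal step (R.u₀ ω) (fun i => R.ξ i ω) j) (R.η j ω)

/-- The empirical measure of the `N`-member EnKF after `j` steps with the data `y`. -/
def enkf (R : Randomness P ρ₀ ν Γ) (step : Euc d → Ξ → Euc d) (H : Matrix (Fin m) (Fin d) ℝ)
    (N : ℕ) (y : ℕ → Euc m) (j : ℕ) (ω : Ω) : Measure (Euc d) :=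
  empirical (ensemble (N := N) step H Γ y (fun n => R.v₀ n ω) (fun i n => R.w i n ω)
    (fun i n => R.ηt i n ω) j)

end Randomness

end

end EnKF

/-! The members of the EnKF interact through the sample covariance and are not independent. They are
compared with a second ensemble, driven by the same initial states, driving noises and
perturbations, whose gain is computed from the mean-field forecast law. For fixed data this gain is
deterministic, so these members are i.i.d. with law `meanField` (`Randomness.map_mfMember`,
`Randomness.indepFun_mfMember`), and the Monte Carlo bound `lintegral_sq_avg_sub_le` gives a mean
square error of order `1 / N` for bounded test functions.

The two ensembles are close pathwise. Since `H C Hᵀ + Γ ≥ Γ`, the inverse in the gain is bounded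
uniformly in the covariance `C`, and the gain is Lipschitz in `C` with a constant that involves only
the reference gain (`norm_gain_sub_gain_le`). The sample covariance of the EnKF forecasts differs
from the mean-field covariance by a coupling error, propagated by the Lipschitz dynamics, and by a
sampling error of the i.i.d. forecasts. The latter is controlled by the deviations of their first
and second empirical moments, which `fluctuation` collects together with the deviation of the mean
squared size of the perturbations. While the total fluctuation `e` is at most one, induction on the
step bounds the mean square distance of the ensembles by `L y * e`
(`exists_avg_sq_norm_ensemble_sub_member_le`). When `e > 1`, test functions bounded by one have
squared differences at most `4 ≤ 4 * e` (`sq_avg_sub_le_of_blNorm_le`). Hence no moment bound for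
the interacting ensemble is ever needed. The expectation of `e` is of order `1 / N`, because fourth
moments of the mean-field forecasts bound the variances of their second-order products.

This proves the bound for fixed data, with a constant `c y`. All constants are tracked as functions
of polynomial growth in `y` (`PolyBdd`). For random data, independence of data and ensemble allows
the error to be computed first for frozen data; then `c` is integrated over the data, which have
moments of all orders. -/

namespace EnKF

/-! ### Bounds and Lipschitz estimates for the Kalman gain and the analysis map -/

section Gain

open scoped Matrix.Norms.L2Operator

variable {d m : ℕ}

lemma norm_toLp_mulVec_le (A : Matrix (Fin m) (Fin d) ℝ) (x : Euc d) :
    ‖WithLp.toLp 2 (A *ᵥ x.ofLp)‖ ≤ ‖A‖ * ‖x‖ :=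
  Matrix.l2_opNorm_mulVec A x

lemma matrix_norm_le {A : Matrix (Fin m) (Fin d) ℝ} {c : ℝ} (hc : 0 ≤ c)
    (h : ∀ x : Euc d, ‖WithLp.toLp 2 (A *ᵥ x.ofLp)‖ ≤ c * ‖x‖) : ‖A‖ ≤ c := by
  rw [Matrix.l2_opNorm_def]
  exact ContinuousLinearMap.opNorm_le_bound _ hc h

lemma matrix_sq_norm_le (A : Matrix (Fin m) (Fin d) ℝ) :
    ‖A‖ ^ 2 ≤ ∑ i, ∑ k, A i k ^ 2 := by
  have h0 : 0 ≤ ∑ i, ∑ k, A i k ^ 2 := by positivity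
  rw [← Real.le_sqrt (norm_nonneg _) h0]
  refine matrix_norm_le (Real.sqrt_nonneg _) fun x => ?_
  rw [← Real.sqrt_sq (norm_nonneg x), ← Real.sqrt_mul h0]
  refine Real.le_sqrt_of_sq_le ?_
  rw [EuclideanSpace.real_norm_sq_eq, EuclideanSpace.real_norm_sq_eq, Finset.sum_mul]
  refine Finset.sum_le_sum fun i _ => ?_
  exact Finset.sum_mul_sq_le_sq_mul_sq Finset.univ (fun k => A i k) (fun k => x k)

lemma norm_transpose (A : Matrix (Fin m) (Fin d) ℝ) : ‖Aᵀ‖ = ‖A‖ := by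
  rw [← Matrix.l2_opNorm_conjTranspose A, Matrix.conjTranspose_eq_transpose_of_trivial]

/-- By compactness the quadratic form of `Γ` attains a positive minimum on the unit sphere; `κ` is
its inverse, and homogeneity extends the bound to all vectors. -/
lemma exists_sq_norm_le_dotProduct {Γ : Matrix (Fin m) (Fin m) ℝ} (hΓ : Γ.PosDef) :
    ∃ κ : ℝ, 0 ≤ κ ∧ ∀ x : Euc m, ‖x‖ ^ 2 ≤ κ * (x.ofLp ⬝ᵥ Γ *ᵥ x.ofLp) := by
  -- The sphere is empty only when `m = 0`, and then every vector vanishes.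
  rcases (Metric.sphere (0 : Euc m) 1).eq_empty_or_nonempty with he | hne
  · refine ⟨0, le_rfl, fun x => ?_⟩
    by_cases hx : x = 0
    · simp [hx]
    · have : (‖x‖⁻¹ • x) ∈ Metric.sphere (0 : Euc m) 1 := by
        simp [norm_smul, norm_ne_zero_iff.2 hx]
      simp [he] at this
  · have hcont : Continuous fun x : Euc m => x.ofLp ⬝ᵥ Γ *ᵥ x.ofLp := by fun_prop
    obtain ⟨x₀, hx₀, hmin⟩ := (isCompact_sphere (0 : Euc m) 1).exists_isMinOn hne hcont.continuousOn
    have hpos : 0 < x₀.ofLp ⬝ᵥ Γ *ᵥ x₀.ofLp := by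
      have := hΓ.dotProduct_mulVec_pos (x := x₀.ofLp) (by
        intro h
        have : x₀ = 0 := by ext i; simp [h]
        simp [this] at hx₀)
      simpa using this
    refine ⟨(x₀.ofLp ⬝ᵥ Γ *ᵥ x₀.ofLp)⁻¹, by positivity, fun x => ?_⟩
    by_cases hx : x = 0
    · simp [hx]
    have hmem : (‖x‖⁻¹ • x) ∈ Metric.sphere (0 : Euc m) 1 := by
      simp [norm_smul, norm_ne_zero_iff.2 hx]
    have h := hmin hmem
    simp only [Set.mem_ofPred_eq, WithLp.ofLp_smul, Matrix.mulVec_smul, dotProduct_smul,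
      smul_dotProduct, smul_eq_mul] at h
    have hn : 0 < ‖x‖ := norm_pos_iff.2 hx
    rw [← div_eq_inv_mul, le_div_iff₀ hpos]
    calc ‖x‖ ^ 2 * (x₀.ofLp ⬝ᵥ Γ *ᵥ x₀.ofLp)
        ≤ ‖x‖ ^ 2 * (‖x‖⁻¹ * (‖x‖⁻¹ * (x.ofLp ⬝ᵥ Γ *ᵥ x.ofLp))) := by gcongr
      _ = _ := by field_simp

/-- The innovation covariance is invertible, with an inverse bounded uniformly in the forecast
covariance. -/
lemma exists_norm_innovation_inv_le (H : Matrix (Fin m) (Fin d) ℝ)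
    {Γ : Matrix (Fin m) (Fin m) ℝ} (hΓ : Γ.PosDef) :
    ∃ κ : ℝ, 0 ≤ κ ∧ ∀ C : Matrix (Fin d) (Fin d) ℝ, C.PosSemidef →
      IsUnit (H * C * Hᵀ + Γ).det ∧ ‖(H * C * Hᵀ + Γ)⁻¹‖ ≤ κ := by
  obtain ⟨κ, hκ, hb⟩ := exists_sq_norm_le_dotProduct hΓ
  refine ⟨κ, hκ, fun C hC => ?_⟩
  have hHC : (H * C * Hᵀ).PosSemidef := by
    simpa using hC.mul_mul_conjTranspose_same H
  have hS : (H * C * Hᵀ + Γ).PosDef := hΓ.posSemidef_add hHC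
  have hdet : IsUnit (H * C * Hᵀ + Γ).det := (Matrix.isUnit_iff_isUnit_det _).1 hS.isUnit
  refine ⟨hdet, matrix_norm_le hκ fun x => ?_⟩
  set S := H * C * Hᵀ + Γ with hSdef
  set v : Euc m := WithLp.toLp 2 (S⁻¹ *ᵥ x.ofLp) with hv
  have hSv : S *ᵥ v.ofLp = x.ofLp := by
    simp [hv, Matrix.mulVec_mulVec, Matrix.mul_nonsing_inv _ hdet]
  -- With `v = S⁻¹ x`, coercivity of `Γ` and `Γ ≤ S` give `‖v‖² ≤ κ ⟨v, S v⟩ = κ ⟨v, x⟩ ≤ κ ‖v‖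
  -- ‖x‖`; one factor `‖v‖` is then cancelled.
  have h1 : v.ofLp ⬝ᵥ Γ *ᵥ v.ofLp ≤ v.ofLp ⬝ᵥ S *ᵥ v.ofLp := by
    have := hHC.dotProduct_mulVec_nonneg v.ofLp
    rw [hSdef, Matrix.add_mulVec, dotProduct_add]
    simp only [star_trivial] at this
    linarith
  have h2 : v.ofLp ⬝ᵥ S *ᵥ v.ofLp ≤ ‖v‖ * ‖x‖ := by
    rw [hSv]
    have := real_inner_le_norm v x
    rwa [EuclideanSpace.inner_eq_star_dotProduct, star_trivial, dotProduct_comm] at this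
  have h3 : ‖v‖ ^ 2 ≤ κ * (‖v‖ * ‖x‖) :=
    (hb v).trans (by gcongr; exact h1.trans h2)
  rcases (norm_nonneg v).eq_or_lt with h0 | h0
  · rw [← h0]; positivity
  · nlinarith

lemma norm_gain_le {H : Matrix (Fin m) (Fin d) ℝ} {Γ : Matrix (Fin m) (Fin m) ℝ} {κ : ℝ}
    {C : Matrix (Fin d) (Fin d) ℝ} (hC : ‖(H * C * Hᵀ + Γ)⁻¹‖ ≤ κ) :
    ‖gain H Γ C‖ ≤ ‖H‖ * κ * ‖C‖ := by
  unfold gain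
  calc ‖C * Hᵀ * (H * C * Hᵀ + Γ)⁻¹‖ ≤ ‖C * Hᵀ‖ * ‖(H * C * Hᵀ + Γ)⁻¹‖ := Matrix.l2_opNorm_mul _ _
    _ ≤ (‖C‖ * ‖Hᵀ‖) * κ := by
        gcongr
        exact Matrix.l2_opNorm_mul _ _
    _ = _ := by rw [norm_transpose]; ring

/-- A resolvent-type identity: multiply by `S = H C Hᵀ + Γ` on the right and use `gain C * S = C
Hᵀ`, and likewise for `C'`. The covariance `C` enters only through `C - C'` and `S⁻¹`, which is
uniformly bounded; this is why the next estimate needs no bound on `C` itself. -/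
lemma gain_sub_gain {H : Matrix (Fin m) (Fin d) ℝ} {Γ : Matrix (Fin m) (Fin m) ℝ}
    {C C' : Matrix (Fin d) (Fin d) ℝ} (hC : IsUnit (H * C * Hᵀ + Γ).det)
    (hC' : IsUnit (H * C' * Hᵀ + Γ).det) :
    gain H Γ C - gain H Γ C' =
      ((C - C') * Hᵀ - gain H Γ C' * (H * (C - C') * Hᵀ)) * (H * C * Hᵀ + Γ)⁻¹ := by
  have h1 : gain H Γ C' * (H * C' * Hᵀ + Γ) = C' * Hᵀ := by
    rw [gain, Matrix.mul_assoc, Matrix.nonsing_inv_mul _ hC', Matrix.mul_one]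
  have h2 : (C - C') * Hᵀ - gain H Γ C' * (H * (C - C') * Hᵀ) =
      C * Hᵀ - gain H Γ C' * (H * C * Hᵀ + Γ) := by
    have h3 : H * (C - C') * Hᵀ = (H * C * Hᵀ + Γ) - (H * C' * Hᵀ + Γ) := by
      simp only [Matrix.mul_sub, Matrix.sub_mul]; abel
    rw [h3, Matrix.mul_sub, h1, Matrix.sub_mul]; abel
  rw [h2, Matrix.sub_mul, Matrix.mul_assoc (gain H Γ C'), Matrix.mul_nonsing_inv _ hC,
    Matrix.mul_one, ← gain]

lemma norm_gain_sub_gain_le {H : Matrix (Fin m) (Fin d) ℝ} {Γ : Matrix (Fin m) (Fin m) ℝ}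
    {C C' : Matrix (Fin d) (Fin d) ℝ} {κ : ℝ} (hC : IsUnit (H * C * Hᵀ + Γ).det)
    (hC' : IsUnit (H * C' * Hᵀ + Γ).det) (hκ : ‖(H * C * Hᵀ + Γ)⁻¹‖ ≤ κ) :
    ‖gain H Γ C - gain H Γ C'‖ ≤ (1 + ‖gain H Γ C'‖ * ‖H‖) * ‖C - C'‖ * ‖H‖ * κ := by
  rw [gain_sub_gain hC hC']
  have h1 : ‖(C - C') * Hᵀ‖ ≤ ‖C - C'‖ * ‖H‖ := by
    rw [← norm_transpose H]; exact Matrix.l2_opNorm_mul _ _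
  have h2 : ‖gain H Γ C' * (H * (C - C') * Hᵀ)‖ ≤ ‖gain H Γ C'‖ * (‖H‖ * (‖C - C'‖ * ‖H‖)) := by
    refine (Matrix.l2_opNorm_mul _ _).trans ?_
    rw [Matrix.mul_assoc]
    gcongr
    refine (Matrix.l2_opNorm_mul _ _).trans ?_
    gcongr
  refine (Matrix.l2_opNorm_mul _ _).trans ?_
  calc _ ≤ (‖C - C'‖ * ‖H‖ + ‖gain H Γ C'‖ * (‖H‖ * (‖C - C'‖ * ‖H‖))) * κ := by
        gcongr
        exact (norm_sub_le _ _).trans (add_le_add h1 h2)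
    _ = _ := by ring

lemma norm_update_le (H : Matrix (Fin m) (Fin d) ℝ) (G : Matrix (Fin d) (Fin m) ℝ)
    (x : Euc d) (z : Euc m) : ‖update H G x z‖ ≤ (1 + ‖G‖ * ‖H‖) * ‖x‖ + ‖G‖ * ‖z‖ := by
  have h : update H G x z = x - WithLp.toLp 2 (G *ᵥ (WithLp.toLp 2 (H *ᵥ x.ofLp)).ofLp)
      + WithLp.toLp 2 (G *ᵥ z.ofLp) := by
    ext i
    simp [update, Matrix.sub_mulVec, Matrix.mulVec_mulVec]
  rw [h]
  have h1 := norm_toLp_mulVec_le G (WithLp.toLp 2 (H *ᵥ x.ofLp))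
  have h2 := norm_toLp_mulVec_le H x
  have h3 := norm_toLp_mulVec_le G z
  have h4 := norm_add_le (x - WithLp.toLp 2 (G *ᵥ (WithLp.toLp 2 (H *ᵥ x.ofLp)).ofLp))
    (WithLp.toLp 2 (G *ᵥ z.ofLp))
  have h5 := norm_sub_le x (WithLp.toLp 2 (G *ᵥ (WithLp.toLp 2 (H *ᵥ x.ofLp)).ofLp))
  have h6 : ‖G‖ * ‖WithLp.toLp 2 (H *ᵥ x.ofLp)‖ ≤ ‖G‖ * (‖H‖ * ‖x‖) := by gcongr
  linarith

/-- The difference splits into the update with gain `G` of `x - x'` by a zero observation, and `G -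
G'` applied to the innovation `z - H x'` of the reference state. -/
lemma norm_update_sub_update_le (H : Matrix (Fin m) (Fin d) ℝ) (G G' : Matrix (Fin d) (Fin m) ℝ)
    (x x' : Euc d) (z : Euc m) :
    ‖update H G x z - update H G' x' z‖ ≤
      (1 + ‖G‖ * ‖H‖) * ‖x - x'‖ + ‖G - G'‖ * (‖z‖ + ‖H‖ * ‖x'‖) := by
  have h : update H G x z - update H G' x' z = update H G (x - x') 0 +
      WithLp.toLp 2 ((G - G') *ᵥ (z - WithLp.toLp 2 (H *ᵥ x'.ofLp)).ofLp) := by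
    ext i
    simp [update, Matrix.sub_mulVec, Matrix.mulVec_mulVec, Matrix.mulVec_sub, Matrix.sub_mul]
    ring
  rw [h]
  have h1 := norm_update_le H G (x - x') 0
  have h2 := norm_toLp_mulVec_le (G - G') (z - WithLp.toLp 2 (H *ᵥ x'.ofLp))
  have h3 := norm_sub_le z (WithLp.toLp 2 (H *ᵥ x'.ofLp))
  have h4 := norm_toLp_mulVec_le H x'
  have h5 : ‖G - G'‖ * ‖z - WithLp.toLp 2 (H *ᵥ x'.ofLp)‖ ≤ ‖G - G'‖ * (‖z‖ + ‖H‖ * ‖x'‖) := by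
    gcongr; linarith
  simp only [norm_zero, mul_zero, add_zero] at h1
  exact (norm_add_le _ _).trans (add_le_add h1 (h2.trans h5))

end Gain

/-- The average of a function over the ensemble members. -/
noncomputable def avg {N : ℕ} (g : Fin N → ℝ) : ℝ := (N : ℝ)⁻¹ * ∑ n, g n

/-! ### Averages over the ensemble -/

section Avg

variable {N : ℕ}

lemma avg_add (f g : Fin N → ℝ) : avg (fun n => f n + g n) = avg f + avg g := by
  simp [avg, Finset.sum_add_distrib, mul_add]

lemma avg_sub (f g : Fin N → ℝ) : avg (fun n => f n - g n) = avg f - avg g := by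
  simp [avg, Finset.sum_sub_distrib, mul_sub]

lemma avg_const_mul (c : ℝ) (g : Fin N → ℝ) : avg (fun n => c * g n) = c * avg g := by
  simp only [avg, ← Finset.mul_sum]; ring

lemma avg_const (hN : 1 ≤ N) (c : ℝ) : avg (fun _ : Fin N => c) = c := by
  have : (N : ℝ) ≠ 0 := by positivity
  simp [avg, this]

lemma avg_mono {f g : Fin N → ℝ} (h : ∀ n, f n ≤ g n) : avg f ≤ avg g := by
  unfold avg
  gcongr
  exact h _

lemma avg_nonneg {g : Fin N → ℝ} (h : ∀ n, 0 ≤ g n) : 0 ≤ avg g :=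
  mul_nonneg (by positivity) (Finset.sum_nonneg fun n _ => h n)

lemma avg_sum {ι : Type*} (s : Finset ι) (g : ι → Fin N → ℝ) :
    avg (fun n => ∑ i ∈ s, g i n) = ∑ i ∈ s, avg (g i) := by
  simp only [avg]
  rw [Finset.sum_comm, Finset.mul_sum]

lemma sq_avg_mul_le (f g : Fin N → ℝ) :
    avg (fun n => f n * g n) ^ 2 ≤ avg (fun n => f n ^ 2) * avg (fun n => g n ^ 2) := by
  unfold avg
  calc _ = (N : ℝ)⁻¹ ^ 2 * (∑ n, f n * g n) ^ 2 := by ring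
    _ ≤ (N : ℝ)⁻¹ ^ 2 * ((∑ n, f n ^ 2) * ∑ n, g n ^ 2) := by
        gcongr
        exact Finset.sum_mul_sq_le_sq_mul_sq Finset.univ f g
    _ = _ := by ring

lemma sq_avg_le (hN : 1 ≤ N) (f : Fin N → ℝ) : avg f ^ 2 ≤ avg (fun n => f n ^ 2) := by
  have := sq_avg_mul_le f fun _ => 1
  simpa [avg_const hN] using this

end Avg

/-! ### Stability of the sample covariance -/

section SampleCov

variable {d N : ℕ}

lemma sq_apply_le_sq_norm (x : Euc d) (i : Fin d) : x i ^ 2 ≤ ‖x‖ ^ 2 := by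
  rw [EuclideanSpace.real_norm_sq_eq]
  exact Finset.single_le_sum (f := fun i => x i ^ 2) (fun i _ => sq_nonneg _) (Finset.mem_univ i)

lemma avg_sq_apply_le (v : Fin N → Euc d) (i : Fin d) :
    avg (fun n => v n i ^ 2) ≤ avg fun n => ‖v n‖ ^ 2 :=
  avg_mono fun _ => sq_apply_le_sq_norm _ i

lemma sampleMean_apply (v : Fin N → Euc d) (i : Fin d) :
    sampleMean v i = avg fun n => v n i := by
  simp [sampleMean, avg]

lemma sampleCov_apply (hN : 1 ≤ N) (v : Fin N → Euc d) (i k : Fin d) :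
    sampleCov v i k =
      avg (fun n => v n i * v n k) - avg (fun n => v n i) * avg fun n => v n k := by
  have h : sampleCov v i k =
      avg fun n => (v n i - avg fun l => v l i) * (v n k - avg fun l => v l k) := by
    simp [sampleCov, avg, Matrix.sum_apply, Matrix.vecMulVec_apply, sampleMean]
  rw [h]
  set a := avg fun l => v l i
  set b := avg fun l => v l k
  have h2 : (fun n => (v n i - a) * (v n k - b)) =
      fun n => ((v n i * v n k - b * v n i) - a * v n k) + a * b := by
    funext n; ring
  rw [h2, avg_add, avg_sub, avg_sub, avg_const_mul, avg_const_mul, avg_const hN]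
  ring

lemma posSemidef_sampleCov (v : Fin N → Euc d) : (sampleCov v).PosSemidef := by
  refine Matrix.PosSemidef.smul (Matrix.posSemidef_sum _ fun n _ => ?_) (by positivity)
  simpa using Matrix.posSemidef_vecMulVec_self_star (v n - sampleMean v).ofLp

/-- Substituting `x = (x - x') + x'` in the moments leaves six terms, each with a factor `x - x'`.
By Cauchy–Schwarz two of their squares are at most `D ^ 2` and four at most `D * A`, whence `12 = 6
* 2` and `24 = 6 * 4`. Apart from the difference, only the second moment of `x'` occurs. -/
lemma sq_sampleCov_sub_le (hN : 1 ≤ N) (x x' : Fin N → Euc d) (i k : Fin d) :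
    (sampleCov x i k - sampleCov x' i k) ^ 2 ≤
      12 * avg (fun n => ‖x n - x' n‖ ^ 2) ^ 2 +
        24 * (avg (fun n => ‖x n - x' n‖ ^ 2) * avg fun n => ‖x' n‖ ^ 2) := by
  set D := avg fun n => ‖x n - x' n‖ ^ 2
  set A := avg fun n => ‖x' n‖ ^ 2
  have hD0 : 0 ≤ D := avg_nonneg fun n => by positivity
  have hA0 : 0 ≤ A := avg_nonneg fun n => by positivity
  have e1 : (fun n => x n i * x n k) = fun n => ((x n - x' n) i * (x n - x' n) k +
      (x n - x' n) i * x' n k + x' n i * (x n - x' n) k) + x' n i * x' n k := by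
    funext n; simp only [PiLp.sub_apply]; ring
  have e2 : ∀ l, (fun n => x n l) = fun n => (x n - x' n) l + x' n l := by
    intro l; funext n; simp
  rw [sampleCov_apply hN, sampleCov_apply hN, e1, e2 i, e2 k]
  simp only [avg_add]
  have hδ : ∀ l, avg (fun n => (x n - x' n) l ^ 2) ≤ D :=
    fun l => avg_sq_apply_le (fun n => x n - x' n) l
  have hx : ∀ l, avg (fun n => x' n l ^ 2) ≤ A := fun l => avg_sq_apply_le x' l
  have hδ0 : ∀ l, 0 ≤ avg (fun n => (x n - x' n) l ^ 2) := fun l => avg_nonneg fun n => sq_nonneg _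
  have hx0 : ∀ l, 0 ≤ avg (fun n => x' n l ^ 2) := fun l => avg_nonneg fun n => sq_nonneg _
  have m1 : ∀ l, avg (fun n => (x n - x' n) l) ^ 2 ≤ D := fun l => (sq_avg_le hN _).trans (hδ l)
  have m2 : ∀ l, avg (fun n => x' n l) ^ 2 ≤ A := fun l => (sq_avg_le hN _).trans (hx l)
  have t1 : avg (fun n => (x n - x' n) i * (x n - x' n) k) ^ 2 ≤ D ^ 2 := by
    rw [sq D]
    exact (sq_avg_mul_le _ _).trans (mul_le_mul (hδ i) (hδ k) (hδ0 k) hD0)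
  have t2 : avg (fun n => (x n - x' n) i * x' n k) ^ 2 ≤ D * A :=
    (sq_avg_mul_le _ _).trans (mul_le_mul (hδ i) (hx k) (hx0 k) hD0)
  have t3 : avg (fun n => x' n i * (x n - x' n) k) ^ 2 ≤ D * A := by
    rw [mul_comm D]
    exact (sq_avg_mul_le _ _).trans (mul_le_mul (hx i) (hδ k) (hδ0 k) hA0)
  have t4 : (avg (fun n => (x n - x' n) i) * avg (fun n => (x n - x' n) k)) ^ 2 ≤ D ^ 2 := by
    rw [mul_pow, sq D]
    exact mul_le_mul (m1 i) (m1 k) (sq_nonneg _) hD0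
  have t5 : (avg (fun n => (x n - x' n) i) * avg (fun n => x' n k)) ^ 2 ≤ D * A := by
    rw [mul_pow]
    exact mul_le_mul (m1 i) (m2 k) (sq_nonneg _) hD0
  have t6 : (avg (fun n => x' n i) * avg (fun n => (x n - x' n) k)) ^ 2 ≤ D * A := by
    rw [mul_pow, mul_comm D]
    exact mul_le_mul (m2 i) (m1 k) (sq_nonneg _) hA0
  generalize avg (fun n => (x n - x' n) i * (x n - x' n) k) = p1 at *
  generalize avg (fun n => (x n - x' n) i * x' n k) = p2 at *
  generalize avg (fun n => x' n i * (x n - x' n) k) = p3 at *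
  generalize avg (fun n => (x n - x' n) i) = q1 at *
  generalize avg (fun n => (x n - x' n) k) = q2 at *
  generalize avg (fun n => x' n i) = r1 at *
  generalize avg (fun n => x' n k) = r2 at *
  -- Cauchy–Schwarz against the vector of ones, which produces the factor `6`.
  have key : ∀ a b c d e f : ℝ, (a + b + c - d - e - f) ^ 2 ≤
      6 * (a ^ 2 + b ^ 2 + c ^ 2 + d ^ 2 + e ^ 2 + f ^ 2) := by
    intro a b c d e f
    have := Finset.sum_mul_sq_le_sq_mul_sq Finset.univ ![a, b, c, -d, -e, -f] (fun _ => (1 : ℝ))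
    simp [Fin.sum_univ_succ] at this
    ring_nf at this ⊢
    linarith
  have := key p1 p2 p3 (q1 * q2) (q1 * r2) (r1 * q2)
  ring_nf at this t1 t2 t3 t4 t5 t6 ⊢
  linarith

/-- The squared deviation of the first and second empirical moments of an ensemble from `μ`
and `q`. -/
noncomputable def momentDev (μ : Fin d → ℝ) (q : Fin d → Fin d → ℝ) (v : Fin N → Euc d) : ℝ :=
  ∑ i, (avg (fun n => v n i) - μ i) ^ 2 +
    ∑ i, ∑ k, (avg (fun n => v n i * v n k) - q i k) ^ 2

lemma sum_sq_nonneg {n : ℕ} (f : Fin n → ℝ) : 0 ≤ ∑ i, f i ^ 2 :=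
  Finset.sum_nonneg fun i _ => sq_nonneg (f i)

lemma sq_le_sum_sq {n : ℕ} (f : Fin n → ℝ) (i : Fin n) : f i ^ 2 ≤ ∑ i, f i ^ 2 :=
  Finset.single_le_sum (f := fun i => f i ^ 2) (fun i _ => sq_nonneg (f i)) (Finset.mem_univ i)

lemma sum_sum_sq_nonneg {n : ℕ} (f : Fin n → Fin n → ℝ) : 0 ≤ ∑ i, ∑ k, f i k ^ 2 :=
  Finset.sum_nonneg fun i _ => sum_sq_nonneg (f i)

lemma sq_le_sum_sum_sq {n : ℕ} (f : Fin n → Fin n → ℝ) (i k : Fin n) :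
    f i k ^ 2 ≤ ∑ i, ∑ k, f i k ^ 2 :=
  (sq_le_sum_sq (f i) k).trans (Finset.single_le_sum (f := fun i => ∑ k, f i k ^ 2)
    (fun i _ => sum_sq_nonneg (f i)) (Finset.mem_univ i))

lemma momentDev_nonneg (μ : Fin d → ℝ) (q : Fin d → Fin d → ℝ) (v : Fin N → Euc d) :
    0 ≤ momentDev μ q v :=
  add_nonneg (sum_sq_nonneg _) (sum_sum_sq_nonneg fun i k => avg (fun n => v n i * v n k) - q i k)

lemma sq_avg_sub_le_momentDev (μ : Fin d → ℝ) (q : Fin d → Fin d → ℝ) (v : Fin N → Euc d)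
    (i : Fin d) : (avg (fun n => v n i) - μ i) ^ 2 ≤ momentDev μ q v :=
  (sq_le_sum_sq (fun i => avg (fun n => v n i) - μ i) i).trans
    (le_add_of_nonneg_right (sum_sum_sq_nonneg fun i k => avg (fun n => v n i * v n k) - q i k))

lemma sq_avg_mul_sub_le_momentDev (μ : Fin d → ℝ) (q : Fin d → Fin d → ℝ) (v : Fin N → Euc d)
    (i k : Fin d) : (avg (fun n => v n i * v n k) - q i k) ^ 2 ≤ momentDev μ q v :=
  (sq_le_sum_sum_sq (fun i k => avg (fun n => v n i * v n k) - q i k) i k).trans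
    (le_add_of_nonneg_left (sum_sq_nonneg fun i => avg (fun n => v n i) - μ i))

/-- The covariance is a polynomial in the moments. Expanding around `(μ, q)` gives three terms
linear in the deviations and one product of two deviations; the condition `momentDev ≤ 1` makes the
square of the product first order in `momentDev` as well. -/
lemma sq_sampleCov_sub_le_momentDev (hN : 1 ≤ N) {μ : Fin d → ℝ} {q : Fin d → Fin d → ℝ}
    {M : ℝ} (hμ : ∀ i, μ i ^ 2 ≤ M) (v : Fin N → Euc d) (hdev : momentDev μ q v ≤ 1)
    (i k : Fin d) :
    (sampleCov v i k - (q i k - μ i * μ k)) ^ 2 ≤ (8 + 8 * M) * momentDev μ q v := by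
  rw [sampleCov_apply hN]
  set e := momentDev μ q v with he
  have he0 : 0 ≤ e := momentDev_nonneg _ _ _
  have h1 := sq_avg_mul_sub_le_momentDev μ q v i k
  have h2 := sq_avg_sub_le_momentDev μ q v i
  have h3 := sq_avg_sub_le_momentDev μ q v k
  rw [← he] at h1 h2 h3
  generalize avg (fun n => v n i * v n k) = p at *
  generalize avg (fun n => v n i) = a at *
  generalize avg (fun n => v n k) = b at *
  have h4 : ((a - μ i) * (b - μ k)) ^ 2 ≤ e := by
    rw [mul_pow]
    calc _ ≤ e * 1 := mul_le_mul h2 (h3.trans hdev) (sq_nonneg _) he0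
      _ = e := mul_one e
  have h5 : ((a - μ i) * μ k) ^ 2 ≤ e * M := by
    rw [mul_pow]; exact mul_le_mul h2 (hμ k) (sq_nonneg _) he0
  have h6 : (μ i * (b - μ k)) ^ 2 ≤ e * M := by
    rw [mul_pow, mul_comm e]
    exact mul_le_mul (hμ i) h3 (sq_nonneg _) ((sq_nonneg _).trans (hμ i))
  have key : ∀ a b c d : ℝ, (a - b - c - d) ^ 2 ≤ 4 * (a ^ 2 + b ^ 2 + c ^ 2 + d ^ 2) := by
    intro a b c d
    nlinarith [sq_nonneg (a + b), sq_nonneg (a + c), sq_nonneg (a + d), sq_nonneg (b - c),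
      sq_nonneg (b - d), sq_nonneg (c - d)]
  have := key (p - q i k) ((a - μ i) * (b - μ k)) ((a - μ i) * μ k) (μ i * (b - μ k))
  have e1 : p - a * b - (q i k - μ i * μ k) =
      p - q i k - (a - μ i) * (b - μ k) - (a - μ i) * μ k - μ i * (b - μ k) := by ring
  rw [e1]
  linarith

/-- The squared norm is the sum of the diagonal products `v i * v i`, and each of their averages
exceeds `q i i` by at most one; the `d` comes from summing over the coordinates. -/
lemma avg_sq_norm_le_of_momentDev {μ : Fin d → ℝ} {q : Fin d → Fin d → ℝ} (v : Fin N → Euc d)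
    (hdev : momentDev μ q v ≤ 1) : avg (fun n => ‖v n‖ ^ 2) ≤ ∑ i, q i i + d := by
  simp only [EuclideanSpace.real_norm_sq_eq, avg_sum]
  calc _ ≤ ∑ i, (q i i + 1) := by
        refine Finset.sum_le_sum fun i _ => ?_
        have h := (sq_avg_mul_sub_le_momentDev μ q v i i).trans hdev
        have h2 := (abs_le.1 ((sq_le_one_iff_abs_le_one _).1 h)).2
        simp only [← sq] at h2
        linarith
    _ = _ := by simp [Finset.sum_add_distrib]

end SampleCov

/-! ### Error propagation through one analysis step -/

section Step

open scoped Matrix.Norms.L2Operator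

variable {d m : ℕ}

lemma matrix_sq_norm_le_of_apply {A : Matrix (Fin d) (Fin d) ℝ} {b : ℝ}
    (h : ∀ i k, A i k ^ 2 ≤ b) : ‖A‖ ^ 2 ≤ d ^ 2 * b := by
  refine (matrix_sq_norm_le A).trans ?_
  calc _ ≤ ∑ _i : Fin d, ∑ _k : Fin d, b :=
        Finset.sum_le_sum fun i _ => Finset.sum_le_sum fun k _ => h i k
    _ = _ := by simp; ring

/-- The a priori bound `B ≥ 1` linearizes the quadratic terms: `D ^ 2` and `D * A` are both at most
`B * D`. Here `72 = 2 * (12 + 24)`. -/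
lemma sq_norm_sampleCov_sub_le {N : ℕ} (hN : 1 ≤ N) (x x' : Fin N → Euc d)
    (C : Matrix (Fin d) (Fin d) ℝ) {B : ℝ} (hB : 1 ≤ B)
    (hDB : avg (fun n => ‖x n - x' n‖ ^ 2) ≤ B) (hAB : avg (fun n => ‖x' n‖ ^ 2) ≤ B) :
    ‖sampleCov x - C‖ ^ 2 ≤ (72 * d ^ 2 + 2) *
      (B * (avg (fun n => ‖x n - x' n‖ ^ 2) + ‖sampleCov x' - C‖ ^ 2)) := by
  have h1 := matrix_sq_norm_le_of_apply (A := sampleCov x - sampleCov x')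
    fun i k => sq_sampleCov_sub_le hN x x' i k
  have h2 : ‖sampleCov x - C‖ ≤ ‖sampleCov x - sampleCov x'‖ + ‖sampleCov x' - C‖ :=
    norm_sub_le_norm_sub_add_norm_sub _ _ _
  have hD0 : 0 ≤ avg fun n => ‖x n - x' n‖ ^ 2 := avg_nonneg fun n => by positivity
  have hs0 : 0 ≤ ‖sampleCov x' - C‖ ^ 2 := by positivity
  have h3 : ‖sampleCov x - C‖ ^ 2 ≤
      2 * ‖sampleCov x - sampleCov x'‖ ^ 2 + 2 * ‖sampleCov x' - C‖ ^ 2 :=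
    (pow_le_pow_left₀ (norm_nonneg _) h2 2).trans (add_sq_le.trans_eq (by ring))
  generalize avg (fun n => ‖x n - x' n‖ ^ 2) = D at *
  generalize avg (fun n => ‖x' n‖ ^ 2) = A at *
  generalize ‖sampleCov x' - C‖ ^ 2 = s at *
  have hB0 : 0 ≤ B := by linarith
  have h4 : D ^ 2 ≤ B * D := by rw [sq]; gcongr
  have h5 : D * A ≤ B * D := by rw [mul_comm]; gcongr
  have h6 : (d : ℝ) ^ 2 * (12 * D ^ 2 + 24 * (D * A)) ≤ d ^ 2 * (36 * (B * D)) := by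
    gcongr; linarith
  have h7 : s ≤ B * s := le_mul_of_one_le_left hs0 hB
  have h8 : 0 ≤ (d : ℝ) ^ 2 * (B * s) := by positivity
  have h9 : 0 ≤ B * D := by positivity
  calc _ ≤ 2 * ((d : ℝ) ^ 2 * (36 * (B * D))) + 2 * (B * s) := by linarith
    _ ≤ _ := by ring_nf; ring_nf at h8 h9; linarith

/-- One analysis step: the updates of two ensembles, by the gain of the sample covariance of the
first and by the gain of a covariance matrix `C`, stay close. -/
lemma exists_avg_sq_norm_update_sub_le (H : Matrix (Fin m) (Fin d) ℝ)
    {Γ : Matrix (Fin m) (Fin m) ℝ} (hΓ : Γ.PosDef) :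
    ∃ c : ℝ, 0 ≤ c ∧ ∀ (N : ℕ) (_ : 1 ≤ N) (x x' : Fin N → Euc d) (z : Fin N → Euc m)
      (C : Matrix (Fin d) (Fin d) ℝ) (_ : C.PosSemidef) (B : ℝ) (_ : 1 ≤ B)
      (_ : avg (fun n => ‖x n - x' n‖ ^ 2) ≤ B) (_ : avg (fun n => ‖x' n‖ ^ 2) ≤ B)
      (_ : avg (fun n => ‖z n‖ ^ 2) ≤ B) (_ : ‖gain H Γ C‖ ≤ B)
      (_ : ‖sampleCov x' - C‖ ^ 2 ≤ B),
      avg (fun n => ‖update H (gain H Γ (sampleCov x)) (x n) (z n) -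
          update H (gain H Γ C) (x' n) (z n)‖ ^ 2) ≤
        c * B ^ 4 * (avg (fun n => ‖x n - x' n‖ ^ 2) + ‖sampleCov x' - C‖ ^ 2) := by
  obtain ⟨κ, hκ0, hκ⟩ := exists_norm_innovation_inv_le H hΓ
  set h := ‖H‖ with hh
  have hh0 : 0 ≤ h := norm_nonneg H
  set c4 : ℝ := (1 + h) ^ 2 * h ^ 2 * κ ^ 2 * (72 * d ^ 2 + 2) with hc4
  have hc40 : 0 ≤ c4 := by positivity
  -- The first summand is twice the constant bounding `(1 + ‖G‖ * h) ^ 2` in `hG1`; the second comes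
  -- from the squared gain difference in `hδ` times the size of the innovations.
  refine ⟨2 * (2 + 4 * h ^ 2 + 8 * h ^ 2 * c4) + 4 * c4 * (1 + h ^ 2), by positivity, ?_⟩
  intro N hN x x' z C hC B hB hDB hAB hzB hgB hsB
  have hg0 := norm_nonneg (gain H Γ C)
  set D := avg fun n => ‖x n - x' n‖ ^ 2 with hD
  set A := avg fun n => ‖x' n‖ ^ 2 with hA
  set Z := avg fun n => ‖z n‖ ^ 2 with hZ
  set s := ‖sampleCov x' - C‖ ^ 2 with hs
  set G := gain H Γ (sampleCov x) with hG
  set G' := gain H Γ C with hG'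
  have hD0 : 0 ≤ D := avg_nonneg fun n => by positivity
  have hA0 : 0 ≤ A := avg_nonneg fun n => by positivity
  have hZ0 : 0 ≤ Z := avg_nonneg fun n => by positivity
  have hs0 : 0 ≤ s := by positivity
  have hB0 : 0 ≤ B := by linarith
  -- Two powers of `B` come from the reference gain and one from the covariance estimate.
  have hδ : ‖G - G'‖ ^ 2 ≤ c4 * B ^ 3 * (D + s) := by
    have hσ := sq_norm_sampleCov_sub_le hN x x' C hB hDB hAB
    rw [← hD, ← hs] at hσ
    have h1 := norm_gain_sub_gain_le (hκ _ (posSemidef_sampleCov x)).1 (hκ _ hC).1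
      (hκ _ (posSemidef_sampleCov x)).2
    rw [← hG, ← hG', ← hh] at h1
    generalize ‖sampleCov x - C‖ = σ at h1 hσ
    generalize ‖G'‖ = g at h1 hgB hg0
    have h2 : 1 + g * h ≤ B * (1 + h) := by
      have : g * h ≤ B * h := by gcongr
      linarith
    have h3 : (1 + g * h) ^ 2 ≤ (B * (1 + h)) ^ 2 := by gcongr
    calc ‖G - G'‖ ^ 2 ≤ ((1 + g * h) * σ * h * κ) ^ 2 :=
          pow_le_pow_left₀ (norm_nonneg _) h1 2
      _ = h ^ 2 * κ ^ 2 * ((1 + g * h) ^ 2 * σ ^ 2) := by ring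
      _ ≤ h ^ 2 * κ ^ 2 * ((B * (1 + h)) ^ 2 * ((72 * d ^ 2 + 2) * (B * (D + s)))) :=
          mul_le_mul_of_nonneg_left (mul_le_mul h3 hσ (sq_nonneg _) (sq_nonneg _)) (by positivity)
      _ = _ := by rw [hc4]; ring
  have hδB : ‖G - G'‖ ^ 2 ≤ 2 * c4 * B ^ 4 := by
    calc _ ≤ c4 * B ^ 3 * (D + s) := hδ
      _ ≤ c4 * B ^ 3 * (B + B) := by gcongr
      _ = _ := by ring
  -- The random gain `G` has no a priori bound; it is controlled through `G'` and the difference `G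
  -- - G'`.
  have hG1 : (1 + ‖G‖ * h) ^ 2 ≤ B ^ 4 * (2 + 4 * h ^ 2 + 8 * h ^ 2 * c4) := by
    have h1 : ‖G‖ ≤ ‖G'‖ + ‖G - G'‖ := norm_le_insert' G G'
    have h2 : ‖G‖ ^ 2 ≤ 2 * B ^ 2 + 2 * ‖G - G'‖ ^ 2 := by
      calc ‖G‖ ^ 2 ≤ (B + ‖G - G'‖) ^ 2 := by gcongr; linarith
        _ ≤ _ := by linarith [add_sq_le (a := B) (b := ‖G - G'‖)]
    have h3 : B ^ 2 ≤ B ^ 4 := pow_le_pow_right₀ hB (by norm_num)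
    have h4 : 1 ≤ B ^ 4 := one_le_pow₀ hB
    calc (1 + ‖G‖ * h) ^ 2 ≤ 2 * (1 + h ^ 2 * ‖G‖ ^ 2) := by
          have := add_sq_le (a := (1 : ℝ)) (b := ‖G‖ * h)
          rw [mul_pow] at this; linarith
      _ ≤ 2 * (B ^ 4 + h ^ 2 * (2 * B ^ 4 + 2 * (2 * c4 * B ^ 4))) := by
          gcongr; linarith
      _ = _ := by ring
  have hn : ∀ n, ‖update H G (x n) (z n) - update H G' (x' n) (z n)‖ ^ 2 ≤
      2 * (1 + ‖G‖ * h) ^ 2 * ‖x n - x' n‖ ^ 2 +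
        (4 * ‖G - G'‖ ^ 2) * (‖z n‖ ^ 2 + h ^ 2 * ‖x' n‖ ^ 2) := by
    intro n
    have h1 := norm_update_sub_update_le H G G' (x n) (x' n) (z n)
    rw [← hh] at h1
    refine (pow_le_pow_left₀ (norm_nonneg _) h1 2).trans (add_sq_le.trans ?_)
    have h2 := add_sq_le (a := ‖z n‖) (b := h * ‖x' n‖)
    have h3 : ‖G - G'‖ ^ 2 * (‖z n‖ + h * ‖x' n‖) ^ 2 ≤
        ‖G - G'‖ ^ 2 * (2 * (‖z n‖ ^ 2 + (h * ‖x' n‖) ^ 2)) := by gcongr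
    rw [mul_pow, mul_pow]
    rw [mul_pow] at h3
    linarith
  refine (avg_mono hn).trans ?_
  rw [avg_add, avg_const_mul, avg_const_mul, avg_add, avg_const_mul, ← hD, ← hA, ← hZ]
  have f1 : 2 * (1 + ‖G‖ * h) ^ 2 * D ≤ 2 * (B ^ 4 * (2 + 4 * h ^ 2 + 8 * h ^ 2 * c4)) * (D + s) := by
    gcongr; linarith
  have f2 : 4 * ‖G - G'‖ ^ 2 * (Z + h ^ 2 * A) ≤ 4 * (c4 * B ^ 3 * (D + s)) * (B + h ^ 2 * B) := by
    gcongr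
  calc _ ≤ _ := add_le_add f1 f2
    _ = _ := by ring

end Step

/-! ### Polynomial growth in the data -/

section PolyBdd

variable {m : ℕ}

/-- Functions of the data of at most polynomial growth, depending on finitely many data. -/
def PolyBdd (c : (ℕ → Euc m) → ℝ) : Prop :=
  ∃ (A : ℝ) (q J : ℕ), 0 ≤ A ∧ ∀ y, |c y| ≤ A * (1 + ∑ i ∈ Finset.range J, ‖y i‖) ^ q

lemma PolyBdd.mono {c c' : (ℕ → Euc m) → ℝ} (h : PolyBdd c') (hc : ∀ y, |c y| ≤ c' y) :
    PolyBdd c := by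
  obtain ⟨A, q, J, hA, hb⟩ := h
  exact ⟨A, q, J, hA, fun y => (hc y).trans ((le_abs_self _).trans (hb y))⟩

lemma PolyBdd.const (a : ℝ) : PolyBdd fun _ : ℕ → Euc m => a :=
  ⟨|a|, 0, 0, abs_nonneg _, fun y => by simp⟩

lemma PolyBdd.norm_apply (i : ℕ) : PolyBdd fun y : ℕ → Euc m => ‖y i‖ := by
  refine ⟨1, 1, i + 1, zero_le_one, fun y => ?_⟩
  rw [abs_norm, one_mul, pow_one, Finset.sum_range_succ]
  have : 0 ≤ ∑ l ∈ Finset.range i, ‖y l‖ := by positivity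
  linarith

/-- The base is at least one, so both the exponent and the number of data may be enlarged. This lets
two growth bounds be brought to a common form in sums and products. -/
lemma one_add_sum_pow_le (y : ℕ → Euc m) {J J' q q' : ℕ} (hJ : J ≤ J') (hq : q ≤ q') :
    (1 + ∑ i ∈ Finset.range J, ‖y i‖) ^ q ≤ (1 + ∑ i ∈ Finset.range J', ‖y i‖) ^ q' := by
  have h0 : 0 ≤ ∑ i ∈ Finset.range J, ‖y i‖ := by positivity
  refine (pow_le_pow_right₀ (by linarith) hq).trans ?_
  gcongr

lemma PolyBdd.add {c c' : (ℕ → Euc m) → ℝ} (h : PolyBdd c) (h' : PolyBdd c') :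
    PolyBdd fun y => c y + c' y := by
  obtain ⟨A, q, J, hA, hb⟩ := h
  obtain ⟨A', q', J', hA', hb'⟩ := h'
  refine ⟨A + A', q + q', J + J', by positivity, fun y => (abs_add_le _ _).trans ?_⟩
  rw [add_mul]
  refine add_le_add ((hb y).trans ?_) ((hb' y).trans ?_)
  · exact mul_le_mul_of_nonneg_left (one_add_sum_pow_le y (by omega) (by omega)) hA
  · exact mul_le_mul_of_nonneg_left (one_add_sum_pow_le y (by omega) (by omega)) hA'

lemma PolyBdd.mul {c c' : (ℕ → Euc m) → ℝ} (h : PolyBdd c) (h' : PolyBdd c') :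
    PolyBdd fun y => c y * c' y := by
  obtain ⟨A, q, J, hA, hb⟩ := h
  obtain ⟨A', q', J', hA', hb'⟩ := h'
  refine ⟨A * A', q + q', J + J', by positivity, fun y => ?_⟩
  rw [abs_mul, pow_add]
  calc _ ≤ (A * (1 + ∑ i ∈ Finset.range J, ‖y i‖) ^ q) *
        (A' * (1 + ∑ i ∈ Finset.range J', ‖y i‖) ^ q') :=
        mul_le_mul (hb y) (hb' y) (abs_nonneg _) (by positivity)
    _ ≤ (A * (1 + ∑ i ∈ Finset.range (J + J'), ‖y i‖) ^ q) *
        (A' * (1 + ∑ i ∈ Finset.range (J + J'), ‖y i‖) ^ q') := by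
        have h1 := one_add_sum_pow_le y (le_add_right (le_refl J) : J ≤ J + J') (le_refl q)
        have h2 := one_add_sum_pow_le y (le_add_left (le_refl J') : J' ≤ J + J') (le_refl q')
        gcongr
    _ = _ := by ring

lemma PolyBdd.pow {c : (ℕ → Euc m) → ℝ} (h : PolyBdd c) (n : ℕ) : PolyBdd fun y => c y ^ n := by
  induction n with
  | zero => simpa using PolyBdd.const 1
  | succ n ih => simpa only [pow_succ] using ih.mul h

/-- Used to average the data-dependent constant over random data. The degree is not known in
advance, so moments of all orders are assumed. -/
lemma PolyBdd.lintegral_lt_top {c : (ℕ → Euc m) → ℝ} (h : PolyBdd c) {Ω : Type*}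
    [MeasurableSpace Ω] {P : Measure Ω} [IsProbabilityMeasure P] {Y : Ω → ℕ → Euc m}
    (hY : ∀ (i : ℕ) (p : ℝ≥0∞), p ≠ ∞ → MemLp (fun ω => Y ω i) p P) :
    ∫⁻ ω, ENNReal.ofReal (c (Y ω)) ∂P < ∞ := by
  obtain ⟨A, q, J, hA, hb⟩ := h
  have hS : ∀ n : ℕ, MemLp (fun ω => 1 + ∑ i ∈ Finset.range J, ‖Y ω i‖) (n : ℝ≥0∞) P := fun n =>
    (memLp_const (1 : ℝ)).add
      (memLp_finsetSum _ fun i _ => (hY i _ (ENNReal.natCast_ne_top n)).norm)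
  -- The exponent is `q + 1` because the integrability of a power is invoked for a nonzero exponent;
  -- since the base is at least one, the larger power still dominates.
  have hint : Integrable (fun ω => A * ‖1 + ∑ i ∈ Finset.range J, ‖Y ω i‖‖ ^ (q + 1)) P :=
    ((hS (q + 1)).integrable_norm_pow q.succ_ne_zero).const_mul A
  refine lt_of_le_of_lt (lintegral_mono fun ω => ENNReal.ofReal_le_ofReal ?_) hint.lintegral_lt_top
  have h0 : 0 ≤ ∑ i ∈ Finset.range J, ‖Y ω i‖ := Finset.sum_nonneg fun i _ => norm_nonneg _
  rw [Real.norm_of_nonneg (by linarith)]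
  exact ((le_abs_self _).trans (hb _)).trans
    (mul_le_mul_of_nonneg_left (pow_le_pow_right₀ (by linarith) q.le_succ) hA)

end PolyBdd

/-! ### Fourth moments and what they control: means, second moments and the covariance -/

section FourthMoment

open scoped Matrix.Norms.L2Operator

variable {d : ℕ}

/-- `π` has a fourth moment bounded by `M`. -/
structure FourthMoment (π : Measure (Euc d)) (M : ℝ) : Prop where
  nonneg : 0 ≤ M
  memLp : MemLp id 4 π
  integral_le : ∫ v, ‖v‖ ^ 4 ∂π ≤ M

lemma FourthMoment.of_lintegral {π : Measure (Euc d)} {M : ℝ} (hM : 0 ≤ M)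
    (h : ∫⁻ v, ‖v‖ₑ ^ (4 : ℝ) ∂π ≤ ENNReal.ofReal M) : FourthMoment π M := by
  have hL : MemLp (id : Euc d → Euc d) 4 π := by
    refine ⟨aestronglyMeasurable_id, ?_⟩
    rw [eLpNorm_lt_top_iff_lintegral_rpow_enorm_lt_top (by norm_num) (by norm_num)]
    exact lt_of_le_of_lt (by simpa using h) ENNReal.ofReal_lt_top
  refine ⟨hM, hL, ?_⟩
  rw [integral_eq_lintegral_of_nonneg_ae (ae_of_all _ fun v => by positivity)
    (by fun_prop)]
  refine ENNReal.toReal_le_of_le_ofReal hM (le_trans (lintegral_mono fun v => ?_) h)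
  rw [ENNReal.ofReal_pow (norm_nonneg _), ofReal_norm, ← ENNReal.rpow_natCast]
  norm_num

lemma FourthMoment.lintegral_le {π : Measure (Euc d)} {M : ℝ} (h : FourthMoment π M) :
    ∫⁻ v, ‖v‖ₑ ^ (4 : ℝ) ∂π ≤ ENNReal.ofReal M := by
  have hint : Integrable (fun v : Euc d => ‖v‖ ^ 4) π :=
    h.memLp.integrable_norm_pow (by norm_num)
  refine le_trans (le_of_eq ?_) (ENNReal.ofReal_le_ofReal h.integral_le)
  rw [ofReal_integral_eq_lintegral_ofReal hint (ae_of_all _ fun v => by positivity)]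
  refine lintegral_congr fun v => ?_
  rw [ENNReal.ofReal_pow (norm_nonneg _), ofReal_norm, ← ENNReal.rpow_natCast]
  norm_num

lemma measurable_apply (i : Fin d) : Measurable fun v : Euc d => v i := by fun_prop

lemma sq_le_one_add_pow_four (a : ℝ) : a ^ 2 ≤ 1 + a ^ 4 := by
  nlinarith [sq_nonneg (a ^ 2 - 1)]

/-- Jensen's inequality for the square, read off from the nonnegativity of the variance. -/
lemma sq_integral_le {Ω : Type*} [MeasurableSpace Ω] {P : Measure Ω} [IsProbabilityMeasure P]
    {X : Ω → ℝ} (hX : MemLp X 2 P) : (∫ ω, X ω ∂P) ^ 2 ≤ ∫ ω, X ω ^ 2 ∂P := by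
  have h := variance_nonneg X P
  rw [variance_eq_sub hX] at h
  simp only [Pi.pow_apply] at h
  linarith

variable {π : Measure (Euc d)} {M : ℝ}

lemma FourthMoment.integrable_norm_pow_four (h : FourthMoment π M) :
    Integrable (fun v : Euc d => ‖v‖ ^ 4) π :=
  h.memLp.integrable_norm_pow (by norm_num)

lemma FourthMoment.memLp_mul (h : FourthMoment π M) (i k : Fin d) :
    MemLp (fun v : Euc d => v i * v k) 2 π := by
  rw [memLp_two_iff_integrable_sq (by fun_prop)]
  refine h.integrable_norm_pow_four.mono' (by fun_prop) (ae_of_all _ fun v => ?_)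
  have h1 := sq_apply_le_sq_norm v i
  have h2 := sq_apply_le_sq_norm v k
  rw [Real.norm_of_nonneg (sq_nonneg _), mul_pow]
  calc _ ≤ ‖v‖ ^ 2 * ‖v‖ ^ 2 := mul_le_mul h1 h2 (sq_nonneg _) (by positivity)
    _ = _ := by ring

variable [IsProbabilityMeasure π]

lemma integral_le_of_le_one_add (h : FourthMoment π M) {g : Euc d → ℝ}
    (hg : ∀ v, g v ≤ 1 + ‖v‖ ^ 4) (hg0 : ∀ v, 0 ≤ g v) : ∫ v, g v ∂π ≤ 1 + M := by
  calc ∫ v, g v ∂π ≤ ∫ v, (1 + ‖v‖ ^ 4) ∂π :=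
        integral_mono_of_nonneg (ae_of_all _ hg0)
          ((integrable_const 1).add h.integrable_norm_pow_four) (ae_of_all _ hg)
    _ = 1 + ∫ v, ‖v‖ ^ 4 ∂π := by
        rw [integral_add (integrable_const 1) h.integrable_norm_pow_four]; simp
    _ ≤ 1 + M := by linarith [h.integral_le]

lemma FourthMoment.memLp_apply (h : FourthMoment π M) (i : Fin d) :
    MemLp (fun v : Euc d => v i) 2 π := by
  have h2 : MemLp (id : Euc d → Euc d) 2 π := h.memLp.mono_exponent (by norm_num)
  exact h2.mono (by fun_prop) (ae_of_all _ fun _ => PiLp.norm_apply_le _ i)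

lemma FourthMoment.integral_sq_apply_le (h : FourthMoment π M) (i : Fin d) :
    ∫ v, v i ^ 2 ∂π ≤ 1 + M :=
  integral_le_of_le_one_add h (fun _ => (sq_apply_le_sq_norm _ i).trans
    (sq_le_one_add_pow_four _)) fun _ => sq_nonneg _

lemma FourthMoment.integral_sq_mul_le (h : FourthMoment π M) (i k : Fin d) :
    ∫ v, (v i * v k) ^ 2 ∂π ≤ 1 + M := by
  refine integral_le_of_le_one_add h (fun v => ?_) fun v => sq_nonneg _
  have h1 := sq_apply_le_sq_norm v i
  have h2 := sq_apply_le_sq_norm v k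
  rw [mul_pow]
  calc _ ≤ ‖v‖ ^ 2 * ‖v‖ ^ 2 := mul_le_mul h1 h2 (sq_nonneg _) (by positivity)
    _ ≤ _ := by ring_nf; linarith

lemma FourthMoment.sq_mean_le (h : FourthMoment π M) (i : Fin d) :
    (∫ v, v i ∂π) ^ 2 ≤ 1 + M :=
  (sq_integral_le (h.memLp_apply i)).trans (h.integral_sq_apply_le i)

lemma FourthMoment.sq_second_le (h : FourthMoment π M) (i k : Fin d) :
    (∫ v, v i * v k ∂π) ^ 2 ≤ 1 + M :=
  (sq_integral_le (h.memLp_mul i k)).trans (h.integral_sq_mul_le i k)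

lemma FourthMoment.second_le (h : FourthMoment π M) (i : Fin d) :
    ∫ v, v i * v i ∂π ≤ 1 + M := by
  simpa only [sq] using h.integral_sq_apply_le i

lemma FourthMoment.covMatrix_apply (h : FourthMoment π M) (i k : Fin d) :
    covMatrix π i k = ∫ v, v i * v k ∂π - (∫ v, v i ∂π) * ∫ v, v k ∂π := by
  simp only [covMatrix, Matrix.of_apply]
  rw [covariance_eq_sub (h.memLp_apply i) (h.memLp_apply k)]
  rfl

/-- The quadratic form at `x` is the variance of `v ↦ ∑ i, x i * v i`. -/
lemma FourthMoment.posSemidef_covMatrix (h : FourthMoment π M) : (covMatrix π).PosSemidef := by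
  refine Matrix.PosSemidef.of_dotProduct_mulVec_nonneg ?_ fun x => ?_
  · ext i k
    simp [covMatrix, covariance_comm]
  · have hx : ∀ i, MemLp (fun v : Euc d => x i * v i) 2 π := fun i => (h.memLp_apply i).const_mul _
    have hv := variance_nonneg (fun v : Euc d => ∑ i, x i * v i) π
    rw [variance_fun_sum hx] at hv
    refine hv.trans_eq ?_
    simp only [star_trivial, dotProduct, Matrix.mulVec, covMatrix, Matrix.of_apply,
      covariance_const_mul_left, covariance_const_mul_right, Finset.mul_sum]
    refine Finset.sum_congr rfl fun i _ => Finset.sum_congr rfl fun k _ => by ring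

lemma FourthMoment.norm_covMatrix_le (h : FourthMoment π M) :
    ‖covMatrix π‖ ≤ d * (2 * (1 + M)) := by
  have hM := h.nonneg
  refine le_of_sq_le_sq ?_ (by positivity)
  rw [mul_pow]
  refine matrix_sq_norm_le_of_apply fun i k => ?_
  rw [h.covMatrix_apply]
  have h1 := h.sq_second_le i k
  have h2 := mul_le_mul (h.sq_mean_le i) (h.sq_mean_le k) (sq_nonneg _) (by positivity)
  rw [← mul_pow] at h2
  generalize ∫ v, v i * v k ∂π = p at *
  generalize (∫ v, v i ∂π) * ∫ v, v k ∂π = q at *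
  nlinarith [sq_nonneg (p + q)]

end FourthMoment

/-! ### Measurability of the gain, the update and the ensemble -/

section Measurability

variable {α : Type*} [MeasurableSpace α] {d m : ℕ}

lemma measurable_matrix_mul {k l n : ℕ} {A : α → Matrix (Fin k) (Fin l) ℝ}
    {B : α → Matrix (Fin l) (Fin n) ℝ} (hA : ∀ i j, Measurable fun a => A a i j)
    (hB : ∀ i j, Measurable fun a => B a i j) (i : Fin k) (j : Fin n) :
    Measurable fun a => (A a * B a) i j := by
  simp only [Matrix.mul_apply]
  exact Finset.measurable_fun_sum _ fun l _ => (hA i l).mul (hB l j)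

/-- The inverse is the adjugate, polynomial in the entries, times the inverse of the determinant.
Real inversion with `0⁻¹ = 0` is measurable, so no invertibility is required. -/
lemma measurable_matrix_inv {A : α → Matrix (Fin m) (Fin m) ℝ}
    (hA : ∀ i j, Measurable fun a => A a i j) (i j : Fin m) :
    Measurable fun a => (A a)⁻¹ i j := by
  have hA' : Measurable fun a => (fun i j => A a i j : Fin m → Fin m → ℝ) :=
    measurable_pi_lambda _ fun i => measurable_pi_lambda _ fun j => hA i j
  have hdetc : Continuous fun B : Fin m → Fin m → ℝ => Matrix.det (Matrix.of B) :=
    (Continuous.matrix_det continuous_id : Continuous fun B : Matrix (Fin m) (Fin m) ℝ => B.det)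
  have hadjc : Continuous fun B : Fin m → Fin m → ℝ => (Matrix.of B).adjugate i j :=
    (Continuous.matrix_adjugate continuous_id :
      Continuous fun B : Matrix (Fin m) (Fin m) ℝ => B.adjugate).matrix_elem i j
  simp only [Matrix.inv_def, Matrix.smul_apply, Ring.inverse_eq_inv', smul_eq_mul]
  exact ((hdetc.measurable.comp hA').inv).mul (hadjc.measurable.comp hA')

lemma measurable_gain (H : Matrix (Fin m) (Fin d) ℝ) (Γ : Matrix (Fin m) (Fin m) ℝ)
    {C : α → Matrix (Fin d) (Fin d) ℝ} (hC : ∀ i j, Measurable fun a => C a i j) (i : Fin d)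
    (j : Fin m) : Measurable fun a => gain H Γ (C a) i j := by
  unfold gain
  refine measurable_matrix_mul
    (measurable_matrix_mul hC (B := fun _ => Hᵀ) fun _ _ => measurable_const)
    (measurable_matrix_inv fun i j => ?_) i j
  simp only [Matrix.add_apply]
  exact (measurable_matrix_mul
    (measurable_matrix_mul (A := fun _ => H) (fun _ _ => measurable_const) hC)
    (B := fun _ => Hᵀ) (fun _ _ => measurable_const) i j).add_const _

lemma measurable_update (H : Matrix (Fin m) (Fin d) ℝ) {G : α → Matrix (Fin d) (Fin m) ℝ}
    {x : α → Euc d} {z : α → Euc m} (hG : ∀ i j, Measurable fun a => G a i j)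
    (hx : Measurable x) (hz : Measurable z) : Measurable fun a => update H (G a) (x a) (z a) := by
  refine (WithLp.measurable_toLp 2 _).comp (measurable_pi_lambda _ fun i => ?_)
  have hx' : ∀ k, Measurable fun a => x a k := fun k => (measurable_apply k).comp hx
  have hz' : ∀ k, Measurable fun a => z a k := fun k => (measurable_apply k).comp hz
  simp only [Pi.add_apply, Matrix.mulVec, dotProduct, Matrix.sub_apply]
  refine (Finset.measurable_fun_sum _ fun k _ => Measurable.mul ?_ (hx' k)).add
    (Finset.measurable_fun_sum _ fun k _ => (hG i k).mul (hz' k))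
  exact measurable_const.sub (measurable_matrix_mul hG (B := fun _ => H) (fun _ _ => measurable_const) i k)

lemma measurable_sampleCov {N : ℕ} {v : α → Fin N → Euc d} (hv : ∀ n, Measurable fun a => v a n)
    (i k : Fin d) : Measurable fun a => sampleCov (v a) i k := by
  have hv' : ∀ n k, Measurable fun a => v a n k := fun n k => (measurable_apply k).comp (hv n)
  simp only [sampleCov, Matrix.smul_apply, Matrix.sum_apply, Matrix.vecMulVec_apply,
    PiLp.sub_apply, sampleMean_apply, avg, smul_eq_mul]
  fun_prop

/-- Only inputs up to step `j` are required to be measurable, and the `σ`-algebra on `α` is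
arbitrary. It can therefore be the one generated by the past, which gives independence from later
noises. -/
lemma measurable_ensemble {N : ℕ} {Ξ : Type*} [MeasurableSpace Ξ] {step : Euc d → Ξ → Euc d}
    (hstep : Measurable (Function.uncurry step)) (H : Matrix (Fin m) (Fin d) ℝ)
    (Γ : Matrix (Fin m) (Fin m) ℝ) {y : α → ℕ → Euc m} {v₀ : α → Fin N → Euc d}
    {w : α → ℕ → Fin N → Ξ} {η : α → ℕ → Fin N → Euc m} (j : ℕ)
    (hy : ∀ i ≤ j, Measurable fun a => y a i) (hv₀ : ∀ n, Measurable fun a => v₀ a n)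
    (hw : ∀ i ≤ j, ∀ n, Measurable fun a => w a i n)
    (hη : ∀ i ≤ j, ∀ n, Measurable fun a => η a i n) (n : Fin N) :
    Measurable fun a => ensemble step H Γ (y a) (v₀ a) (w a) (η a) j n := by
  induction j generalizing n with
  | zero => exact hv₀ n
  | succ j ih =>
    have ih' := ih (fun i hi => hy i (by omega)) (fun i hi => hw i (by omega))
      (fun i hi => hη i (by omega))
    have hf : ∀ n, Measurable fun a =>
        step (ensemble step H Γ (y a) (v₀ a) (w a) (η a) j n) (w a (j + 1) n) := fun n =>
      hstep.comp ((ih' n).prodMk (hw (j + 1) le_rfl n))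
    exact measurable_update H (fun i k => measurable_gain H Γ (measurable_sampleCov hf) i k) (hf n)
      ((hy (j + 1) le_rfl).add (hη (j + 1) le_rfl n))

end Measurability

/-! ### Laws of the mean-field EnKF: measurability in the data and moment growth -/

section MeanField

lemma exists_fourthMoment_bind {d : ℕ} {K : Kernel (Euc d) (Euc d)}
    (hMom : ∃ C' : ℝ≥0, ∀ μ : Measure (Euc d), IsProbabilityMeasure μ →
      ∫⁻ u, ‖u‖ₑ ^ (4 : ℝ) ∂μ < ∞ →
      ∫⁻ v, ‖v‖ₑ ^ (4 : ℝ) ∂(μ.bind K) ≤ C' * (1 + ∫⁻ u, ‖u‖ₑ ^ (4 : ℝ) ∂μ)) :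
    ∃ C' : ℝ, 0 ≤ C' ∧ ∀ (π : Measure (Euc d)) [IsProbabilityMeasure π] (M : ℝ),
      FourthMoment π M → FourthMoment (π.bind K) (C' * (1 + M)) := by
  obtain ⟨C', h⟩ := hMom
  refine ⟨C', C'.2, fun π _ M hπ => ?_⟩
  have hM := hπ.nonneg
  refine FourthMoment.of_lintegral (by positivity) ?_
  refine (h π inferInstance (lt_of_le_of_lt hπ.lintegral_le ENNReal.ofReal_lt_top)).trans ?_
  rw [ENNReal.ofReal_mul (NNReal.coe_nonneg C'), ENNReal.ofReal_add zero_le_one hM, ENNReal.ofReal_one,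
    ENNReal.ofReal_coe_nnreal]
  gcongr
  exact hπ.lintegral_le

variable {d m : ℕ} (K : Kernel (Euc d) (Euc d)) [IsMarkovKernel K]
  (H : Matrix (Fin m) (Fin d) ℝ) (Γ : Matrix (Fin m) (Fin m) ℝ)

lemma isProbabilityMeasure_bind (π : Measure (Euc d)) [IsProbabilityMeasure π] :
    IsProbabilityMeasure (π.bind K) := inferInstance

lemma measurable_update_add (G : Matrix (Fin d) (Fin m) ℝ) (y : Euc m) :
    Measurable fun p : Euc d × Euc m => update H G p.1 (y + p.2) :=
  measurable_update H (fun _ _ => measurable_const) measurable_fst (measurable_snd.const_add y)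

lemma isProbabilityMeasure_meanFieldUpdate (y : Euc m) (π : Measure (Euc d))
    [IsProbabilityMeasure π] : IsProbabilityMeasure (meanFieldUpdate H Γ y π) :=
  Measure.isProbabilityMeasure_map (measurable_update_add H _ y).aemeasurable

variable (ρ₀ : Measure (Euc d)) [IsProbabilityMeasure ρ₀]

instance isProbabilityMeasure_meanField (y : ℕ → Euc m) (j : ℕ) :
    IsProbabilityMeasure (meanField K H Γ ρ₀ y j) := by
  induction j with
  | zero => assumption
  | succ j ih => exact isProbabilityMeasure_meanFieldUpdate H Γ _ _

lemma measurable_covMatrix {α : Type*} [MeasurableSpace α] (κ : Kernel α (Euc d))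
    [IsMarkovKernel κ] (i k : Fin d) : Measurable fun a => covMatrix (κ a) i k := by
  have hm : ∀ i, Measurable fun a => ∫ v, v i ∂κ a := fun i =>
    (StronglyMeasurable.integral_kernel_prod_right (κ := κ) (f := fun _ v => v i)
      ((measurable_apply i).comp measurable_snd).stronglyMeasurable).measurable
  have h : StronglyMeasurable (Function.uncurry fun (a : α) (v : Euc d) =>
      (v i - ∫ u, u i ∂κ a) * (v k - ∫ u, u k ∂κ a)) :=
    ((((measurable_apply i).comp measurable_snd).sub ((hm i).comp measurable_fst)).mul
      (((measurable_apply k).comp measurable_snd).sub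
        ((hm k).comp measurable_fst))).stronglyMeasurable
  exact (StronglyMeasurable.integral_kernel_prod_right h).measurable

/-- Needed to integrate over random data. If the forecast law is a Markov kernel in `y`, so is its
product with the Gaussian, and the mass that the updated law gives to a set is the mass of a section
of a jointly measurable set. -/
lemma measurable_meanField (j : ℕ) :
    Measurable fun y : ℕ → Euc m => meanField K H Γ ρ₀ y j := by
  induction j with
  | zero => exact measurable_const
  | succ j ih =>
    have hb : Measurable fun y : ℕ → Euc m => (meanField K H Γ ρ₀ y j).bind K :=
      (Measure.measurable_bind' K.measurable).comp ih
    let κ : Kernel (ℕ → Euc m) (Euc d) := ⟨fun y => (meanField K H Γ ρ₀ y j).bind K, hb⟩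
    have hκ : IsMarkovKernel κ := ⟨fun y => isProbabilityMeasure_bind K _⟩
    have hU : Measurable fun p : (ℕ → Euc m) × (Euc d × Euc m) =>
        update H (gain H Γ (covMatrix (κ p.1))) p.2.1 (p.1 (j + 1) + p.2.2) :=
      measurable_update H
        (fun i k => (measurable_gain H Γ (measurable_covMatrix κ) i k).comp measurable_fst)
        (measurable_fst.comp measurable_snd)
        (((measurable_pi_apply (j + 1)).comp measurable_fst).add
          (measurable_snd.comp measurable_snd))
    refine Measure.measurable_of_measurable_coe _ fun s hs => ?_
    have h := Kernel.measurable_kernel_prodMk_left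
      (κ := κ ×ₖ Kernel.const (ℕ → Euc m) (multivariateGaussian (0 : Euc m) Γ)) (hU hs)
    have e : (fun y => meanField K H Γ ρ₀ y (j + 1) s) = fun y =>
        (κ ×ₖ Kernel.const (ℕ → Euc m) (multivariateGaussian (0 : Euc m) Γ)) y (Prod.mk y ⁻¹'
          ((fun p : (ℕ → Euc m) × (Euc d × Euc m) =>
            update H (gain H Γ (covMatrix (κ p.1))) p.2.1 (p.1 (j + 1) + p.2.2)) ⁻¹' s)) := by
      funext y
      simp only [meanField, meanFieldUpdate]
      rw [Measure.map_apply (measurable_update_add H _ _) hs, Kernel.prod_apply]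
      rfl
    rw [e]
    exact h

open scoped Matrix.Norms.L2Operator in
-- The update is linear in the forecast, the datum and the perturbation, and `1 + g * ‖H‖ + g`
-- dominates all coefficients.
lemma FourthMoment.meanFieldUpdate {π : Measure (Euc d)} [IsProbabilityMeasure π] {M Mη g : ℝ}
    (h : FourthMoment π M) (hη : FourthMoment (multivariateGaussian (0 : Euc m) Γ) Mη)
    (hg : ‖gain H Γ (covMatrix π)‖ ≤ g) (y : Euc m) :
    FourthMoment (meanFieldUpdate H Γ y π)
      ((1 + g * ‖H‖ + g) ^ 4 * (64 * (M + ‖y‖ ^ 4 + Mη))) := by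
  have hM := h.nonneg
  have hMη := hη.nonneg
  have hg0 : 0 ≤ g := (norm_nonneg _).trans hg
  refine FourthMoment.of_lintegral (by positivity) ?_
  rw [EnKF.meanFieldUpdate, lintegral_map (by fun_prop) (measurable_update_add H _ y)]
  set G := gain H Γ (covMatrix π)
  set a := 1 + g * ‖H‖ + g with ha
  set γ := multivariateGaussian (0 : Euc m) Γ
  have i1 : Integrable (fun p : Euc d × Euc m => ‖p.1‖ ^ 4) (π.prod γ) :=
    h.integrable_norm_pow_four.comp_fst γ
  have i2 : Integrable (fun p : Euc d × Euc m => ‖p.2‖ ^ 4) (π.prod γ) :=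
    hη.integrable_norm_pow_four.comp_snd π
  have i3 : Integrable (fun p : Euc d × Euc m => ‖p.1‖ ^ 4 + ‖y‖ ^ 4 + ‖p.2‖ ^ 4) (π.prod γ) :=
    (i1.add (integrable_const _)).add i2
  have e : ∫ p : Euc d × Euc m, a ^ 4 * (64 * (‖p.1‖ ^ 4 + ‖y‖ ^ 4 + ‖p.2‖ ^ 4)) ∂(π.prod γ) =
      a ^ 4 * (64 * (∫ v, ‖v‖ ^ 4 ∂π + ‖y‖ ^ 4 + ∫ v, ‖v‖ ^ 4 ∂γ)) := by
    have i4 : Integrable (fun p : Euc d × Euc m => ‖p.1‖ ^ 4 + ‖y‖ ^ 4) (π.prod γ) :=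
      i1.add (integrable_const _)
    rw [integral_const_mul, integral_const_mul, integral_add i4 i2,
      integral_add i1 (integrable_const _), integral_fun_fst (fun v : Euc d => ‖v‖ ^ 4),
      integral_fun_snd (fun v : Euc m => ‖v‖ ^ 4)]
    simp
  have hle : ∀ p : Euc d × Euc m, ‖update H G p.1 (y + p.2)‖ ^ 4 ≤
      a ^ 4 * (64 * (‖p.1‖ ^ 4 + ‖y‖ ^ 4 + ‖p.2‖ ^ 4)) := by
    intro p
    have h1 := norm_update_le H G p.1 (y + p.2)
    have h2 := norm_add_le y p.2
    have h3 : ‖update H G p.1 (y + p.2)‖ ≤ a * (‖p.1‖ + ‖y‖ + ‖p.2‖) := by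
      calc _ ≤ (1 + g * ‖H‖) * ‖p.1‖ + g * (‖y‖ + ‖p.2‖) := by
            refine h1.trans ?_
            gcongr
        _ ≤ a * ‖p.1‖ + a * (‖y‖ + ‖p.2‖) := by
            gcongr
            · linarith
            · have : 0 ≤ g * ‖H‖ := by positivity
              linarith
        _ = _ := by ring
    -- Two applications of `(s + t) ^ 4 ≤ 8 * (s ^ 4 + t ^ 4)` give the factor `64`.
    have h4 := add_pow_le (norm_nonneg p.1) (norm_nonneg y) 4
    have h5 := add_pow_le (add_nonneg (norm_nonneg p.1) (norm_nonneg y)) (norm_nonneg p.2) 4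
    have h6 : 0 ≤ ‖p.2‖ ^ 4 := by positivity
    refine (pow_le_pow_left₀ (norm_nonneg _) h3 4).trans ?_
    rw [mul_pow]
    refine mul_le_mul_of_nonneg_left ?_ (by positivity)
    norm_num at h4 h5
    linarith
  calc _ ≤ ∫⁻ p : Euc d × Euc m,
        ENNReal.ofReal (a ^ 4 * (64 * (‖p.1‖ ^ 4 + ‖y‖ ^ 4 + ‖p.2‖ ^ 4))) ∂(π.prod γ) := by
        refine lintegral_mono fun p => ?_
        refine le_trans (le_of_eq ?_) (ENNReal.ofReal_le_ofReal (hle p))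
        rw [ENNReal.ofReal_pow (norm_nonneg _), ofReal_norm, ← ENNReal.rpow_natCast]
        norm_num
    _ = ENNReal.ofReal (a ^ 4 * (64 * (∫ v, ‖v‖ ^ 4 ∂π + ‖y‖ ^ 4 + ∫ v, ‖v‖ ^ 4 ∂γ))) := by
        rw [← e, ofReal_integral_eq_lintegral_ofReal ((i3.const_mul _).const_mul _)
          (ae_of_all _ fun p => by positivity)]
    _ ≤ _ := by
        have h1 := h.integral_le
        have h2 := hη.integral_le
        refine ENNReal.ofReal_le_ofReal ?_
        gcongr

lemma exists_fourthMoment_gaussian :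
    ∃ M, FourthMoment (multivariateGaussian (0 : Euc m) Γ) M :=
  ⟨_, integral_nonneg fun v => by positivity, IsGaussian.memLp_id _ 4 (by norm_num), le_rfl⟩

open scoped Matrix.Norms.L2Operator in
variable {Γ} {K} in
/-- The forecast laws of the mean-field EnKF have fourth moments, and their gains have norms, of
polynomial growth in the data. -/
lemma exists_fourthMoment_forecast (hΓ : Γ.PosDef)
    (hMom : ∃ C' : ℝ≥0, ∀ μ : Measure (Euc d), IsProbabilityMeasure μ →
      ∫⁻ u, ‖u‖ₑ ^ (4 : ℝ) ∂μ < ∞ →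
      ∫⁻ v, ‖v‖ₑ ^ (4 : ℝ) ∂(μ.bind K) ≤ C' * (1 + ∫⁻ u, ‖u‖ₑ ^ (4 : ℝ) ∂μ))
    (hρ₀ : ∫⁻ u, ‖u‖ₑ ^ (4 : ℝ) ∂ρ₀ < ∞) (j : ℕ) :
    ∃ M g : (ℕ → Euc m) → ℝ, PolyBdd M ∧ PolyBdd g ∧ ∀ y,
      FourthMoment ((meanField K H Γ ρ₀ y j).bind K) (M y) ∧
      ‖gain H Γ (covMatrix ((meanField K H Γ ρ₀ y j).bind K))‖ ≤ g y := by
  obtain ⟨C', hC', hbind⟩ := exists_fourthMoment_bind hMom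
  obtain ⟨Mη, hη⟩ := exists_fourthMoment_gaussian Γ
  obtain ⟨κ, hκ0, hκ⟩ := exists_norm_innovation_inv_le H hΓ
  have hgain : ∀ (π : Measure (Euc d)) [IsProbabilityMeasure π] (M : ℝ), FourthMoment π M →
      ‖gain H Γ (covMatrix π)‖ ≤ ‖H‖ * κ * (d * (2 * (1 + M))) := fun π _ M hπ =>
    (norm_gain_le (hκ _ hπ.posSemidef_covMatrix).2).trans
      (mul_le_mul_of_nonneg_left hπ.norm_covMatrix_le (by positivity))
  have key : ∀ {M : (ℕ → Euc m) → ℝ}, PolyBdd M →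
      PolyBdd (fun y => C' * (1 + M y)) ∧
      PolyBdd (fun y => ‖H‖ * κ * (d * (2 * (1 + C' * (1 + M y))))) := by
    intro M hM
    have h1 : PolyBdd (fun y => C' * (1 + M y)) :=
      (PolyBdd.const C').mul ((PolyBdd.const 1).add hM)
    exact ⟨h1, (PolyBdd.const (‖H‖ * κ)).mul ((PolyBdd.const (d : ℝ)).mul
      ((PolyBdd.const 2).mul ((PolyBdd.const 1).add h1)))⟩
  -- The forecast moments and the gain are bounded in terms of the moments of the analysis law, so
  -- the induction runs over analysis laws only.
  suffices hs : ∃ M, PolyBdd M ∧ ∀ y, FourthMoment (meanField K H Γ ρ₀ y j) (M y) by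
    obtain ⟨M, hM, h⟩ := hs
    exact ⟨_, _, (key hM).1, (key hM).2, fun y => ⟨hbind _ _ (h y), hgain _ _ (hbind _ _ (h y))⟩⟩
  induction j with
  | zero =>
    refine ⟨fun _ => (∫⁻ u, ‖u‖ₑ ^ (4 : ℝ) ∂ρ₀).toReal, PolyBdd.const _, fun y => ?_⟩
    exact FourthMoment.of_lintegral ENNReal.toReal_nonneg (ENNReal.ofReal_toReal hρ₀.ne).ge
  | succ j ih =>
    obtain ⟨M, hM, h⟩ := ih
    refine ⟨_, ?_, fun y => (hbind _ _ (h y)).meanFieldUpdate H Γ hη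
      (hgain _ _ (hbind _ _ (h y))) (y (j + 1))⟩
    obtain ⟨h1, h2⟩ := key hM
    exact (((PolyBdd.const 1).add (h2.mul (PolyBdd.const _))).add h2).pow 4 |>.mul
      ((PolyBdd.const 64).mul ((h1.add ((PolyBdd.norm_apply (j + 1)).pow 4)).add
        (PolyBdd.const Mη)))

end MeanField

/-! ### Pathwise coupling of the EnKF with the mean-field ensemble -/

section Coupling

variable {d m : ℕ} {Ξ : Type*}

/-- A member of the mean-field ensemble: the dynamics of the EnKF with prescribed gains `G`. -/
def member (step : Euc d → Ξ → Euc d) (H : Matrix (Fin m) (Fin d) ℝ)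
    (G : ℕ → Matrix (Fin d) (Fin m) ℝ) (y : ℕ → Euc m) (v₀ : Euc d) (w : ℕ → Ξ)
    (η : ℕ → Euc m) : ℕ → Euc d
  | 0 => v₀
  | j + 1 => update H (G j) (step (member step H G y v₀ w η j) (w (j + 1)))
      (y (j + 1) + η (j + 1))

lemma measurable_member {α : Type*} [MeasurableSpace α] [MeasurableSpace Ξ]
    {step : Euc d → Ξ → Euc d} (hstep : Measurable (Function.uncurry step))
    (H : Matrix (Fin m) (Fin d) ℝ) (G : ℕ → Matrix (Fin d) (Fin m) ℝ) (y : ℕ → Euc m)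
    {v₀ : α → Euc d} {w : α → ℕ → Ξ} {η : α → ℕ → Euc m} (j : ℕ) (hv₀ : Measurable v₀)
    (hw : ∀ i ≤ j, Measurable fun a => w a i) (hη : ∀ i ≤ j, Measurable fun a => η a i) :
    Measurable fun a => member step H G y (v₀ a) (w a) (η a) j := by
  induction j with
  | zero => exact hv₀
  | succ j ih =>
    have ih' := ih (fun i hi => hw i (by omega)) (fun i hi => hη i (by omega))
    exact measurable_update H (fun _ _ => measurable_const)
      (hstep.comp (ih'.prodMk (hw (j + 1) le_rfl))) ((hη (j + 1) le_rfl).const_add _)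

variable (K : Kernel (Euc d) (Euc d)) (step : Euc d → Ξ → Euc d)
  (H : Matrix (Fin m) (Fin d) ℝ) (Γ : Matrix (Fin m) (Fin m) ℝ) (ρ₀ : Measure (Euc d))

/-- The forecast law of the mean-field EnKF. -/
noncomputable def forecastLaw (y : ℕ → Euc m) (j : ℕ) : Measure (Euc d) :=
  (meanField K H Γ ρ₀ y j).bind K

/-- The gain of the mean-field EnKF. -/
noncomputable def meanFieldGain (y : ℕ → Euc m) (j : ℕ) : Matrix (Fin d) (Fin m) ℝ :=
  gain H Γ (covMatrix (forecastLaw K H Γ ρ₀ y j))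

/-- The forecast of a member of the mean-field ensemble. -/
noncomputable def memberForecast (y : ℕ → Euc m) (v₀ : Euc d) (w : ℕ → Ξ) (η : ℕ → Euc m)
    (j : ℕ) : Euc d :=
  step (member step H (meanFieldGain K H Γ ρ₀ y) y v₀ w η j) (w (j + 1))

/-- The fluctuation, at one step, of the empirical moments of the mean-field ensemble and of the
perturbations. -/
noncomputable def fluctuation {N : ℕ} (y : ℕ → Euc m) (v₀ : Fin N → Euc d) (w : ℕ → Fin N → Ξ)
    (η : ℕ → Fin N → Euc m) (j : ℕ) : ℝ :=
  momentDev (fun i => ∫ v, v i ∂forecastLaw K H Γ ρ₀ y j)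
      (fun i k => ∫ v, v i * v k ∂forecastLaw K H Γ ρ₀ y j)
      (fun n => memberForecast K step H Γ ρ₀ y (v₀ n) (fun i => w i n) (fun i => η i n) j) +
    (avg (fun n => ‖η (j + 1) n‖ ^ 2) - ∫ z, ‖z‖ ^ 2 ∂multivariateGaussian (0 : Euc m) Γ) ^ 2

lemma fluctuation_nonneg {N : ℕ} (y : ℕ → Euc m) (v₀ : Fin N → Euc d) (w : ℕ → Fin N → Ξ)
    (η : ℕ → Fin N → Euc m) (j : ℕ) : 0 ≤ fluctuation K step H Γ ρ₀ y v₀ w η j :=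
  add_nonneg (momentDev_nonneg _ _ _) (sq_nonneg _)

variable [IsMarkovKernel K] [IsProbabilityMeasure ρ₀]

instance isProbabilityMeasure_forecastLaw (y : ℕ → Euc m) (j : ℕ) :
    IsProbabilityMeasure (forecastLaw K H Γ ρ₀ y j) :=
  isProbabilityMeasure_bind K _

open scoped Matrix.Norms.L2Operator in
/-- Pathwise, as long as the fluctuations are at most one, they control the distance between the
EnKF and the mean-field ensemble. -/
lemma exists_avg_sq_norm_ensemble_sub_member_le (hΓ : Γ.PosDef)
    (hMom : ∃ C' : ℝ≥0, ∀ μ : Measure (Euc d), IsProbabilityMeasure μ →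
      ∫⁻ u, ‖u‖ₑ ^ (4 : ℝ) ∂μ < ∞ →
      ∫⁻ v, ‖v‖ₑ ^ (4 : ℝ) ∂(μ.bind K) ≤ C' * (1 + ∫⁻ u, ‖u‖ₑ ^ (4 : ℝ) ∂μ))
    (hρ₀ : ∫⁻ u, ‖u‖ₑ ^ (4 : ℝ) ∂ρ₀ < ∞) (Λ : ℝ) (j : ℕ) :
    ∃ L : (ℕ → Euc m) → ℝ, PolyBdd L ∧ (∀ y, 0 ≤ L y) ∧
      ∀ (y : ℕ → Euc m) (N : ℕ) (_ : 1 ≤ N) (v₀ : Fin N → Euc d) (w : ℕ → Fin N → Ξ)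
        (η : ℕ → Fin N → Euc m)
        (_ : ∀ i n, ‖step (ensemble step H Γ y v₀ w η i n) (w (i + 1) n) -
            memberForecast K step H Γ ρ₀ y (v₀ n) (fun i => w i n) (fun i => η i n) i‖ ≤
          Λ * ‖ensemble step H Γ y v₀ w η i n - member step H (meanFieldGain K H Γ ρ₀ y) y (v₀ n)
            (fun i => w i n) (fun i => η i n) i‖)
        (_ : ∑ i ∈ Finset.range j, fluctuation K step H Γ ρ₀ y v₀ w η i ≤ 1),
        avg (fun n => ‖ensemble step H Γ y v₀ w η j n - member step H (meanFieldGain K H Γ ρ₀ y) y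
            (v₀ n) (fun i => w i n) (fun i => η i n) j‖ ^ 2) ≤
          L y * ∑ i ∈ Finset.range j, fluctuation K step H Γ ρ₀ y v₀ w η i := by
  obtain ⟨c, hc, hstep⟩ := exists_avg_sq_norm_update_sub_le H hΓ
  induction j with
  | zero =>
    -- Both ensembles start from the same states.
    refine ⟨fun _ => 0, PolyBdd.const 0, fun _ => le_rfl, ?_⟩
    intro y N hN v₀ w η _ _
    simp [ensemble, member, avg]
  | succ j ih =>
    obtain ⟨L, hL, hL0, ih⟩ := ih
    obtain ⟨M, g, hM, hg, hb⟩ := exists_fourthMoment_forecast H ρ₀ hΓ hMom hρ₀ j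
    set z₂ := ∫ z, ‖z‖ ^ 2 ∂multivariateGaussian (0 : Euc m) Γ with hz₂
    have hz₂0 : 0 ≤ z₂ := integral_nonneg fun z => by positivity
    have hM0 : ∀ y, 0 ≤ M y := fun y => (hb y).1.nonneg
    have hg0 : ∀ y, 0 ≤ g y := fun y => (norm_nonneg _).trans (hb y).2
    set S : (ℕ → Euc m) → ℝ := fun y => d ^ 2 * (8 + 8 * (1 + M y)) with hS
    have hS0 : ∀ y, 0 ≤ S y := fun y => by have := hM0 y; positivity
    -- One summand for each a priori bound required by the analysis step: `1 ≤ B`, forecast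
    -- difference, second moment of the mean-field forecasts, perturbed observations, gain and
    -- covariance error.
    set B : (ℕ → Euc m) → ℝ := fun y => 1 + Λ ^ 2 * L y + (d * (1 + M y) + d) +
      (2 * ‖y (j + 1)‖ ^ 2 + 2 * (z₂ + 1)) + g y + S y with hB
    have hSp : PolyBdd S := (PolyBdd.const _).mul ((PolyBdd.const 8).add
      ((PolyBdd.const 8).mul ((PolyBdd.const 1).add hM)))
    have hBp : PolyBdd B := by
      refine PolyBdd.add (PolyBdd.add (PolyBdd.add (PolyBdd.add (PolyBdd.add ?_ ?_) ?_) ?_) hg) hSp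
      · exact PolyBdd.const 1
      · exact (PolyBdd.const _).mul hL
      · exact ((PolyBdd.const _).mul ((PolyBdd.const 1).add hM)).add (PolyBdd.const _)
      · exact ((PolyBdd.const 2).mul ((PolyBdd.norm_apply (j + 1)).pow 2)).add (PolyBdd.const _)
    refine ⟨fun y => c * B y ^ 4 * (Λ ^ 2 * L y + S y), ((PolyBdd.const c).mul (hBp.pow 4)).mul
      (((PolyBdd.const _).mul hL).add hSp), fun y => ?_, ?_⟩
    · have := hL0 y
      have := hS0 y
      positivity
    intro y N hN v₀ w η hlip hE
    have hM0 := hM0 y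
    have hg0 := hg0 y
    have hS0 := hS0 y
    have hL0 := hL0 y
    rw [Finset.sum_range_succ] at hE ⊢
    have hE0 : 0 ≤ ∑ i ∈ Finset.range j, fluctuation K step H Γ ρ₀ y v₀ w η i :=
      Finset.sum_nonneg fun i _ => fluctuation_nonneg _ _ _ _ _ _ _ _ _ _
    have he0 := fluctuation_nonneg K step H Γ ρ₀ y v₀ w η j
    have ih' := ih y N hN v₀ w η hlip (by linarith)
    obtain ⟨hF, hgain⟩ := hb y
    change FourthMoment (forecastLaw K H Γ ρ₀ y j) (M y) at hF
    change ‖gain H Γ (covMatrix (forecastLaw K H Γ ρ₀ y j))‖ ≤ g y at hgain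
    set x : Fin N → Euc d := fun n => step (ensemble step H Γ y v₀ w η j n) (w (j + 1) n) with hx
    set x' : Fin N → Euc d := fun n =>
      memberForecast K step H Γ ρ₀ y (v₀ n) (fun i => w i n) (fun i => η i n) j with hx'
    set E := ∑ i ∈ Finset.range j, fluctuation K step H Γ ρ₀ y v₀ w η i with hEdef
    have hdev : momentDev (fun i => ∫ v, v i ∂forecastLaw K H Γ ρ₀ y j)
        (fun i k => ∫ v, v i * v k ∂forecastLaw K H Γ ρ₀ y j) x' ≤
          fluctuation K step H Γ ρ₀ y v₀ w η j := le_add_of_nonneg_right (sq_nonneg _)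
    have hpert : (avg (fun n => ‖η (j + 1) n‖ ^ 2) - z₂) ^ 2 ≤
        fluctuation K step H Γ ρ₀ y v₀ w η j := le_add_of_nonneg_left (momentDev_nonneg _ _ _)
    set e := fluctuation K step H Γ ρ₀ y v₀ w η j
    have hdev1 := hdev.trans (show e ≤ 1 by linarith)
    have hΔ : avg (fun n => ‖x n - x' n‖ ^ 2) ≤ Λ ^ 2 * L y * E := by
      calc _ ≤ Λ ^ 2 * avg (fun n => ‖ensemble step H Γ y v₀ w η j n - member step H
            (meanFieldGain K H Γ ρ₀ y) y (v₀ n) (fun i => w i n) (fun i => η i n) j‖ ^ 2) := by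
            rw [← avg_const_mul]
            refine avg_mono fun n => ?_
            rw [← mul_pow]
            exact pow_le_pow_left₀ (norm_nonneg _) (hlip j n) 2
        _ ≤ Λ ^ 2 * (L y * E) := mul_le_mul_of_nonneg_left ih' (by positivity)
        _ = _ := by ring
    have hs : ‖sampleCov x' - covMatrix (forecastLaw K H Γ ρ₀ y j)‖ ^ 2 ≤ S y * e := by
      refine (matrix_sq_norm_le_of_apply fun i k => ?_).trans_eq
        (by rw [hS, mul_assoc] : (d : ℝ) ^ 2 * ((8 + 8 * (1 + M y)) * e) = S y * e)
      rw [Matrix.sub_apply, hF.covMatrix_apply]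
      exact (sq_sampleCov_sub_le_momentDev hN hF.sq_mean_le x' hdev1 i k).trans
        (mul_le_mul_of_nonneg_left hdev (by positivity))
    have hA : avg (fun n => ‖x' n‖ ^ 2) ≤ d * (1 + M y) + d := by
      refine (avg_sq_norm_le_of_momentDev x' hdev1).trans (add_le_add_left ?_ _)
      refine (Finset.sum_le_sum fun i _ => hF.second_le i).trans_eq ?_
      simp only [Finset.sum_const, Finset.card_univ, Fintype.card_fin, nsmul_eq_mul]
    have hz : avg (fun n => ‖y (j + 1) + η (j + 1) n‖ ^ 2) ≤
        2 * ‖y (j + 1)‖ ^ 2 + 2 * (z₂ + 1) := by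
      have h1 := (abs_le.1 ((sq_le_one_iff_abs_le_one _).1 (hpert.trans (by linarith)))).2
      calc _ ≤ avg (fun n => 2 * ‖y (j + 1)‖ ^ 2 + 2 * ‖η (j + 1) n‖ ^ 2) := by
            refine avg_mono fun n => ?_
            refine (pow_le_pow_left₀ (norm_nonneg _) (norm_add_le _ _) 2).trans ?_
            exact add_sq_le.trans_eq (by ring)
        _ = 2 * ‖y (j + 1)‖ ^ 2 + 2 * avg (fun n => ‖η (j + 1) n‖ ^ 2) := by
            rw [avg_add, avg_const hN, avg_const_mul]
        _ ≤ _ := by linarith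
    have hy0 : 0 ≤ ‖y (j + 1)‖ ^ 2 := by positivity
    have hd0 : 0 ≤ d * (1 + M y) + d := by positivity
    have hΛL : 0 ≤ Λ ^ 2 * L y := by positivity
    have hΔB : Λ ^ 2 * L y * E ≤ Λ ^ 2 * L y := mul_le_of_le_one_right hΛL (by linarith)
    have hsB : S y * e ≤ S y := mul_le_of_le_one_right hS0 (by linarith)
    have key := hstep N hN x x' (fun n => y (j + 1) + η (j + 1) n)
      (covMatrix (forecastLaw K H Γ ρ₀ y j)) hF.posSemidef_covMatrix (B y)
      (by simp only [hB]; linarith) (by simp only [hB]; linarith) (by simp only [hB]; linarith)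
      (by simp only [hB]; linarith) (by simp only [hB]; linarith) (by simp only [hB]; linarith)
    have hcB : 0 ≤ c * B y ^ 4 := mul_nonneg hc (Even.pow_nonneg (by decide) _)
    -- The past fluctuation `E` carries the factor `Λ ^ 2 * L y` and the new one `e` the factor `S
    -- y`; adding the nonnegative cross terms factors the sum.
    have h1 : 0 ≤ Λ ^ 2 * L y * e := mul_nonneg hΛL he0
    have h2 : 0 ≤ S y * E := mul_nonneg hS0 hE0
    have h3 : avg (fun n => ‖x n - x' n‖ ^ 2) +
        ‖sampleCov x' - covMatrix (forecastLaw K H Γ ρ₀ y j)‖ ^ 2 ≤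
          (Λ ^ 2 * L y + S y) * (E + e) := by linarith
    exact (key.trans (mul_le_mul_of_nonneg_left h3 hcB)).trans_eq (mul_assoc _ _ _).symm

end Coupling

/-! ### The Monte Carlo error -/

section MonteCarlo

variable {Ω E : Type*} [MeasurableSpace Ω] [MeasurableSpace E] {P : Measure Ω}
  [IsProbabilityMeasure P]

/-- The mean square error of the Monte Carlo method for pairwise independent samples. -/
lemma lintegral_sq_avg_sub_le {π : Measure E} [IsProbabilityMeasure π] {X : ℕ → Ω → E}
    (hX : ∀ n, Measurable (X n)) (hlaw : ∀ n, P.map (X n) = π)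
    (hind : Pairwise fun i j => IndepFun (X i) (X j) P) {g : E → ℝ} (hg : Measurable g)
    (hg2 : MemLp g 2 π) {N : ℕ} (hN : 1 ≤ N) :
    ∫⁻ ω, ENNReal.ofReal ((avg (fun n : Fin N => g (X n ω)) - ∫ x, g x ∂π) ^ 2) ∂P ≤
      ENNReal.ofReal ((∫ x, g x ^ 2 ∂π) / N) := by
  have hmp : ∀ n, MeasurePreserving (X n) P π := fun n => ⟨hX n, hlaw n⟩
  have hL : ∀ n, MemLp (fun ω => g (X n ω)) 2 P := fun n => hg2.comp_measurePreserving (hmp n)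
  have hmean : ∀ n, ∫ ω, g (X n ω) ∂P = ∫ x, g x ∂π := fun n => by
    rw [← hlaw n, integral_map (hX n).aemeasurable hg.aestronglyMeasurable]
  have hvar : ∀ n, Var[fun ω => g (X n ω); P] ≤ ∫ x, g x ^ 2 ∂π := fun n => by
    refine (variance_le_expectation_sq (hL n).1).trans_eq ?_
    rw [← hlaw n, integral_map (hX n).aemeasurable (hg.pow_const 2).aestronglyMeasurable]
    rfl
  set Z : Ω → ℝ := fun ω => avg fun n : Fin N => g (X n ω) with hZ
  have hZL : MemLp Z 2 P := (memLp_finsetSum _ fun (n : Fin N) _ => hL n).const_mul _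
  have hZmean : ∫ ω, Z ω ∂P = ∫ x, g x ∂π := by
    simp only [hZ, avg]
    rw [integral_const_mul, integral_finsetSum _ fun (n : Fin N) _ =>
      (hL n).integrable (by norm_num)]
    simp only [hmean]
    exact avg_const hN _
  have hNpos : (0 : ℝ) < N := by positivity
  have hZvar : Var[Z; P] ≤ (∫ x, g x ^ 2 ∂π) / N := by
    have h1 : Var[∑ n : Fin N, fun ω => g (X n ω); P] = ∑ n : Fin N, Var[fun ω => g (X n ω); P] :=
      IndepFun.variance_sum (fun n _ => hL n) fun i _ j _ hij =>
        (hind (fun h => hij (Fin.ext h))).comp hg hg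
    have h2 : Z = fun ω => (N : ℝ)⁻¹ * (∑ n : Fin N, fun ω => g (X n ω)) ω := by
      funext ω; simp [hZ, avg]
    rw [h2, variance_const_mul, h1]
    calc _ ≤ (N : ℝ)⁻¹ ^ 2 * ∑ _n : Fin N, ∫ x, g x ^ 2 ∂π := by
          gcongr with n; exact hvar n
      _ = _ := by simp; field_simp
  have hint : Integrable (fun ω => (Z ω - ∫ ω, Z ω ∂P) ^ 2) P :=
    (hZL.sub (memLp_const _)).integrable_sq
  rw [← hZmean]
  change ∫⁻ ω, ENNReal.ofReal ((Z ω - ∫ ω, Z ω ∂P) ^ 2) ∂P ≤ _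
  rw [← ofReal_integral_eq_lintegral_ofReal hint (ae_of_all _ fun ω => sq_nonneg _),
    ← variance_eq_integral hZL.1.aemeasurable]
  exact ENNReal.ofReal_le_ofReal hZvar

end MonteCarlo

/-! ### Independence, null sets and the law of one step of the dynamics -/

section Independence

/-- The null set of `hae` may depend on `a`, so a random `a` cannot be substituted directly.
Independence makes the joint law a product, and Fubini shows that the exceptional set is null. -/
lemma IndepFun.ae_prop {Ω A B : Type*} [MeasurableSpace Ω] [MeasurableSpace A]
    [MeasurableSpace B] {P : Measure Ω} [IsProbabilityMeasure P] {X : Ω → A} {W : Ω → B}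
    (hX : Measurable X) (hW : Measurable W) (h : IndepFun X W P) {p : A × B → Prop}
    (hp : MeasurableSet {z | p z}) (hae : ∀ a, ∀ᵐ b ∂P.map W, p (a, b)) :
    ∀ᵐ ω ∂P, p (X ω, W ω) := by
  have : IsProbabilityMeasure (P.map W) := Measure.isProbabilityMeasure_map hW.aemeasurable
  have h1 := (indepFun_iff_map_prod_eq_prod_map_map hX.aemeasurable hW.aemeasurable).1 h
  have h2 : ∀ᵐ z ∂P.map (fun ω => (X ω, W ω)), p z := by
    rw [h1, Measure.ae_prod_iff_ae_ae hp]
    exact ae_of_all _ hae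
  exact ae_of_ae_map (hX.prodMk hW).aemeasurable h2

variable {d : ℕ} {Ξ : Type*} [MeasurableSpace Ξ] {K : Kernel (Euc d) (Euc d)}

lemma DrivingNoise.map_prod_eq_bind (D : DrivingNoise K Ξ) (π : Measure (Euc d))
    [IsProbabilityMeasure π] : (π.prod D.law).map (Function.uncurry D.step) = π.bind K := by
  have := D.isProbabilityMeasure_law
  ext s hs
  rw [Measure.map_apply D.measurable_step hs, Measure.prod_apply (D.measurable_step hs),
    Measure.bind_apply hs K.aemeasurable]
  refine lintegral_congr fun a => ?_
  have ha : Measurable (D.step a) := D.measurable_step.comp measurable_prodMk_left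
  rw [← D.map_step a, Measure.map_apply ha hs]
  rfl

lemma DrivingNoise.map_step_eq_bind (D : DrivingNoise K Ξ) {Ω : Type*} [MeasurableSpace Ω]
    {P : Measure Ω} [IsProbabilityMeasure P] {X : Ω → Euc d} {W : Ω → Ξ} (hX : Measurable X)
    (hW : Measurable W) (hlaw : P.map W = D.law) (h : IndepFun X W P) :
    P.map (fun ω => D.step (X ω) (W ω)) = (P.map X).bind K := by
  have : IsProbabilityMeasure (P.map X) := Measure.isProbabilityMeasure_map hX.aemeasurable
  rw [← D.map_prod_eq_bind, ← hlaw,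
    ← (indepFun_iff_map_prod_eq_prod_map_map hX.aemeasurable hW.aemeasurable).1 h,
    Measure.map_map D.measurable_step (hX.prodMk hW)]
  rfl

end Independence

/-! ### The sources of randomness and the `σ`-algebras they generate -/

namespace Randomness

variable {Ω : Type*} [MeasurableSpace Ω] {P : Measure Ω} {d m : ℕ} {ρ₀ : Measure (Euc d)}
  {Ξ : Type*} [MeasurableSpace Ξ] {ν : Measure Ξ} {Γ : Matrix (Fin m) (Fin m) ℝ}

/-- The `σ`-algebra of a source of randomness. -/
@[reducible] def source (R : Randomness P ρ₀ ν Γ) : Source → MeasurableSpace Ω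
  | .signalInit => MeasurableSpace.comap R.u₀ inferInstance
  | .signalNoise j => MeasurableSpace.comap (R.ξ j) inferInstance
  | .obsNoise j => MeasurableSpace.comap (R.η j) inferInstance
  | .memberInit n => MeasurableSpace.comap (R.v₀ n) inferInstance
  | .memberNoise j n => MeasurableSpace.comap (R.w j n) inferInstance
  | .memberPert j n => MeasurableSpace.comap (R.ηt j n) inferInstance

/-- The `σ`-algebra generated by a set of sources of randomness. -/
@[reducible] def sources (R : Randomness P ρ₀ ν Γ) (S : Set Source) : MeasurableSpace Ω :=
  ⨆ s ∈ S, R.source s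

lemma source_le (R : Randomness P ρ₀ ν Γ) (s : Source) : R.source s ≤ ‹MeasurableSpace Ω› := by
  cases s with
  | signalInit => exact R.measurable_u₀.comap_le
  | signalNoise j => exact (R.measurable_ξ j).comap_le
  | obsNoise j => exact (R.measurable_η j).comap_le
  | memberInit n => exact (R.measurable_v₀ n).comap_le
  | memberNoise j n => exact (R.measurable_w j n).comap_le
  | memberPert j n => exact (R.measurable_ηt j n).comap_le

lemma sources_le (R : Randomness P ρ₀ ν Γ) (S : Set Source) :
    R.sources S ≤ ‹MeasurableSpace Ω› :=
  iSup₂_le fun s _ => R.source_le s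

lemma source_le_sources (R : Randomness P ρ₀ ν Γ) {S : Set Source} {s : Source} (hs : s ∈ S) :
    R.source s ≤ R.sources S :=
  le_iSup₂_of_le s hs le_rfl

/-- Grouping independent `σ`-algebras along disjoint sets of labels preserves independence. Every
independence claim below thus reduces to disjointness of sets of labels. -/
lemma indepFun_of_disjoint (R : Randomness P ρ₀ ν Γ) {S T : Set Source} (hST : Disjoint S T)
    {A B : Type*} [MeasurableSpace A] [MeasurableSpace B] {f : Ω → A} {g : Ω → B}
    (hf : Measurable[R.sources S] f) (hg : Measurable[R.sources T] g) : IndepFun f g P := by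
  have hind : iIndep R.source P := by
    -- The `match` in the field `indep` and `source` agree only after a case distinction on the
    -- label.
    refine Eq.mp (congrArg (fun F : Source → MeasurableSpace Ω => iIndep F P)
      (funext fun s => ?_)) R.indep
    cases s <;> rfl
  have h := indep_iSup_of_disjoint R.source_le hind hST
  rw [IndepFun_iff_Indep]
  exact indep_of_indep_of_le_left (indep_of_indep_of_le_right h hg.comap_le) hf.comap_le

variable (R : Randomness P ρ₀ ν Γ) {S : Set Source}

lemma sources_v₀ {n : ℕ} (h : Source.memberInit n ∈ S) : Measurable[R.sources S] (R.v₀ n) :=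
  (comap_measurable (R.v₀ n)).mono (R.source_le_sources h) le_rfl

lemma sources_w {j n : ℕ} (h : Source.memberNoise j n ∈ S) : Measurable[R.sources S] (R.w j n) :=
  (comap_measurable (R.w j n)).mono (R.source_le_sources h) le_rfl

lemma sources_ηt {j n : ℕ} (h : Source.memberPert j n ∈ S) : Measurable[R.sources S] (R.ηt j n) :=
  (comap_measurable (R.ηt j n)).mono (R.source_le_sources h) le_rfl

lemma sources_u₀ (h : Source.signalInit ∈ S) : Measurable[R.sources S] R.u₀ :=
  (comap_measurable R.u₀).mono (R.source_le_sources h) le_rfl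

lemma sources_ξ {j : ℕ} (h : Source.signalNoise j ∈ S) : Measurable[R.sources S] (R.ξ j) :=
  (comap_measurable (R.ξ j)).mono (R.source_le_sources h) le_rfl

lemma sources_η {j : ℕ} (h : Source.obsNoise j ∈ S) : Measurable[R.sources S] (R.η j) :=
  (comap_measurable (R.η j)).mono (R.source_le_sources h) le_rfl

/-- The sources of the `n`-th member up to step `j`. -/
def memberPast (n j : ℕ) : Set Source :=
  {s | s = .memberInit n ∨ ∃ i ≤ j, s = .memberNoise i n ∨ s = .memberPert i n}

/-- The sources of the ensemble up to step `j`. -/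
def ensemblePast (j : ℕ) : Set Source := ⋃ n, memberPast n j

/-- The sources of the signal and of the observations. -/
def signalSources : Set Source :=
  {s | s = .signalInit ∨ ∃ i, s = .signalNoise i ∨ s = .obsNoise i}

/-- The sources of the signal up to step `j`. -/
def signalPast (j : ℕ) : Set Source :=
  {s | s = .signalInit ∨ ∃ i ≤ j, s = .signalNoise i}

lemma disjoint_memberPast {n n' : ℕ} (h : n ≠ n') (j j' : ℕ) :
    Disjoint (memberPast n j) (memberPast n' j') := by
  rw [Set.disjoint_left]
  rintro s (rfl | ⟨i, hi, rfl | rfl⟩) (h' | ⟨i', hi', h' | h'⟩) <;> simp_all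

lemma disjoint_signalSources_ensemblePast (j : ℕ) :
    Disjoint signalSources (ensemblePast j) := by
  rw [Set.disjoint_left]
  simp only [ensemblePast, Set.mem_iUnion, not_exists]
  rintro s (rfl | ⟨i, rfl | rfl⟩) n (h' | ⟨i', hi', h' | h'⟩) <;> simp_all

end Randomness

/-! ### The mean-field ensemble consists of i.i.d. samples of the mean-field law -/

namespace Randomness

variable {Ω : Type*} [MeasurableSpace Ω] {P : Measure Ω} {d m : ℕ} {ρ₀ : Measure (Euc d)}
  {Ξ : Type*} [MeasurableSpace Ξ] {K : Kernel (Euc d) (Euc d)} {D : DrivingNoise K Ξ}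
  {Γ : Matrix (Fin m) (Fin m) ℝ} (R : Randomness P ρ₀ D.law Γ) (H : Matrix (Fin m) (Fin d) ℝ)

/-- The `n`-th member of the mean-field ensemble. -/
noncomputable def mfMember (y : ℕ → Euc m) (n j : ℕ) (ω : Ω) : Euc d :=
  member D.step H (meanFieldGain K H Γ ρ₀ y) y (R.v₀ n ω) (fun i => R.w i n ω)
    (fun i => R.ηt i n ω) j

/-- The forecast of the `n`-th member of the mean-field ensemble. -/
noncomputable def mfForecast (y : ℕ → Euc m) (n j : ℕ) (ω : Ω) : Euc d :=
  memberForecast K D.step H Γ ρ₀ y (R.v₀ n ω) (fun i => R.w i n ω) (fun i => R.ηt i n ω) j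

/-- The `n`-th member of the `N`-member EnKF. -/
noncomputable def enkfMember (N : ℕ) (y : ℕ → Euc m) (j : ℕ) (ω : Ω) (n : Fin N) : Euc d :=
  ensemble D.step H Γ y (fun n : Fin N => R.v₀ n ω) (fun i n => R.w i n ω) (fun i n => R.ηt i n ω) j n

lemma sources_mfMember (y : ℕ → Euc m) (n j : ℕ) {S : Set Source} (hS : memberPast n j ⊆ S) :
    Measurable[R.sources S] (R.mfMember H y n j) :=
  -- The generated `σ`-algebra is passed explicitly in place of the ambient one on `Ω`.
  @measurable_member d m Ξ Ω (R.sources S) _ D.step D.measurable_step H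
    (meanFieldGain K H Γ ρ₀ y) y (R.v₀ n) (fun ω i => R.w i n ω) (fun ω i => R.ηt i n ω) j
    (R.sources_v₀ (hS (Or.inl rfl)))
    (fun i hi => R.sources_w (hS (Or.inr ⟨i, hi, Or.inl rfl⟩)))
    (fun i hi => R.sources_ηt (hS (Or.inr ⟨i, hi, Or.inr rfl⟩)))

lemma sources_mfForecast (y : ℕ → Euc m) (n j : ℕ) {S : Set Source} (hS : memberPast n j ⊆ S)
    (hS' : Source.memberNoise (j + 1) n ∈ S) : Measurable[R.sources S] (R.mfForecast H y n j) :=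
  D.measurable_step.comp ((R.sources_mfMember H y n j hS).prodMk (R.sources_w hS'))

lemma sources_enkfMember {N : ℕ} (y : ℕ → Euc m) (j : ℕ) (n : Fin N) {S : Set Source}
    (hS : ensemblePast j ⊆ S) : Measurable[R.sources S] fun ω => R.enkfMember H N y j ω n :=
  @measurable_ensemble Ω (R.sources S) d m N Ξ _ D.step D.measurable_step H Γ (fun _ => y)
    (fun ω n => R.v₀ n ω) (fun ω i n => R.w i n ω) (fun ω i n => R.ηt i n ω) j
    (fun _ _ => measurable_const)
    (fun n => R.sources_v₀ (hS (Set.mem_iUnion.2 ⟨n, Or.inl rfl⟩)))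
    (fun i hi n => R.sources_w (hS (Set.mem_iUnion.2 ⟨n, Or.inr ⟨i, hi, Or.inl rfl⟩⟩)))
    (fun i hi n => R.sources_ηt (hS (Set.mem_iUnion.2 ⟨n, Or.inr ⟨i, hi, Or.inr rfl⟩⟩))) n

lemma memberPast_subset_succ (n j : ℕ) : memberPast n j ⊆ memberPast n (j + 1) := by
  rintro s (rfl | ⟨i, hi, h⟩)
  · exact Or.inl rfl
  · exact Or.inr ⟨i, by omega, h⟩

lemma measurable_mfMember (y : ℕ → Euc m) (n j : ℕ) : Measurable (R.mfMember H y n j) :=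
  (R.sources_mfMember H y n j subset_rfl).mono (R.sources_le _) le_rfl

lemma measurable_mfForecast (y : ℕ → Euc m) (n j : ℕ) : Measurable (R.mfForecast H y n j) :=
  D.measurable_step.comp ((R.measurable_mfMember H y n j).prodMk (R.measurable_w _ _))

lemma measurable_enkfMember {N : ℕ} (y : ℕ → Euc m) (j : ℕ) (n : Fin N) :
    Measurable fun ω => R.enkfMember H N y j ω n :=
  (R.sources_enkfMember H y j n subset_rfl).mono (R.sources_le _) le_rfl

lemma indepFun_mfMember (y : ℕ → Euc m) (j : ℕ) :
    Pairwise fun n n' => IndepFun (R.mfMember H y n j) (R.mfMember H y n' j) P :=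
  fun _ _ h => R.indepFun_of_disjoint (disjoint_memberPast h j j)
    (R.sources_mfMember H y _ j subset_rfl) (R.sources_mfMember H y _ j subset_rfl)

lemma indepFun_mfForecast (y : ℕ → Euc m) (j : ℕ) :
    Pairwise fun n n' => IndepFun (R.mfForecast H y n j) (R.mfForecast H y n' j) P :=
  fun _ _ h => R.indepFun_of_disjoint (disjoint_memberPast h (j + 1) (j + 1))
    (R.sources_mfForecast H y _ j (memberPast_subset_succ _ j)
      (Or.inr ⟨j + 1, le_rfl, Or.inl rfl⟩))
    (R.sources_mfForecast H y _ j (memberPast_subset_succ _ j)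
      (Or.inr ⟨j + 1, le_rfl, Or.inl rfl⟩))

lemma indepFun_ηt (j : ℕ) : Pairwise fun n n' => IndepFun (R.ηt j n) (R.ηt j n') P :=
  fun _ _ h => R.indepFun_of_disjoint (disjoint_memberPast h j j)
    (R.sources_ηt (Or.inr ⟨j, le_rfl, Or.inr rfl⟩)) (R.sources_ηt (Or.inr ⟨j, le_rfl, Or.inr rfl⟩))

variable [IsProbabilityMeasure P]

/-- The noise of step `j + 1` is not among the sources of the member up to step `j`. Isolated as an
implication because it is used within the induction of `map_mfMember`. -/
lemma map_mfForecast_of_map_mfMember {y : ℕ → Euc m} {n j : ℕ}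
    (h : P.map (R.mfMember H y n j) = meanField K H Γ ρ₀ y j) :
    P.map (R.mfForecast H y n j) = forecastLaw K H Γ ρ₀ y j := by
  have hind : IndepFun (R.mfMember H y n j) (R.w (j + 1) n) P :=
    R.indepFun_of_disjoint (S := memberPast n j) (T := {Source.memberNoise (j + 1) n})
      (by
        rw [Set.disjoint_singleton_right]
        rintro (h | ⟨i, hi, h | h⟩) <;> simp at h
        omega)
      (R.sources_mfMember H y n j subset_rfl) (R.sources_w rfl)
  rw [forecastLaw, ← h]
  exact D.map_step_eq_bind (R.measurable_mfMember H y n j) (R.measurable_w _ _) (R.map_w _ _) hind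

/-- The prescribed gain is that of `forecastLaw`, which by induction is the actual law of the
forecast, and the new perturbation is independent of that forecast. The member therefore undergoes
exactly the mean-field update. -/
lemma map_mfMember (y : ℕ → Euc m) (n j : ℕ) :
    P.map (R.mfMember H y n j) = meanField K H Γ ρ₀ y j := by
  induction j with
  | zero => exact R.map_v₀ n
  | succ j ih =>
    have hf := R.map_mfForecast_of_map_mfMember H ih
    have hind : IndepFun (R.mfForecast H y n j) (R.ηt (j + 1) n) P :=
      R.indepFun_of_disjoint (S := insert (Source.memberNoise (j + 1) n) (memberPast n j))
        (T := {Source.memberPert (j + 1) n})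
        (by
          rw [Set.disjoint_singleton_right]
          rintro (h | h | ⟨i, hi, h | h⟩) <;> simp at h
          omega)
        (R.sources_mfForecast H y n j (Set.subset_insert _ _) (Set.mem_insert _ _))
        (R.sources_ηt rfl)
    have h1 := (indepFun_iff_map_prod_eq_prod_map_map
      (R.measurable_mfForecast H y n j).aemeasurable
      (R.measurable_ηt (j + 1) n).aemeasurable).1 hind
    rw [hf, R.map_ηt] at h1
    change _ = ((forecastLaw K H Γ ρ₀ y j).prod (multivariateGaussian 0 Γ)).map _
    rw [← h1, Measure.map_map (measurable_update_add H _ _)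
      ((R.measurable_mfForecast H y n j).prodMk (R.measurable_ηt (j + 1) n))]
    rfl

lemma map_mfForecast (y : ℕ → Euc m) (n j : ℕ) :
    P.map (R.mfForecast H y n j) = forecastLaw K H Γ ρ₀ y j :=
  R.map_mfForecast_of_map_mfMember H (R.map_mfMember H y n j)

/-- Almost surely, the forecasts of the EnKF and of the mean-field ensemble differ at most by the
Lipschitz constant times the difference of the states. -/
lemma ae_norm_step_sub_le {C : ℝ}
    (hLip : ∀ a b : Euc d, ∀ᵐ ξ ∂D.law, ‖D.step a ξ - D.step b ξ‖ ≤ C * ‖a - b‖)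
    (y : ℕ → Euc m) (N : ℕ) :
    ∀ᵐ ω ∂P, ∀ (j : ℕ) (n : Fin N),
      ‖D.step (R.enkfMember H N y j ω n) (R.w (j + 1) n ω) - R.mfForecast H y n j ω‖ ≤
        C * ‖R.enkfMember H N y j ω n - R.mfMember H y n j ω‖ := by
  rw [ae_all_iff]; intro j
  rw [ae_all_iff]; intro n
  -- The EnKF member depends on all members through the gain, so the past of the whole ensemble is
  -- needed; the new noise, shared by both states, is not part of it.
  have hind : IndepFun (fun ω => (R.enkfMember H N y j ω n, R.mfMember H y n j ω))
      (R.w (j + 1) n) P :=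
    R.indepFun_of_disjoint (S := ensemblePast j) (T := {Source.memberNoise (j + 1) n})
      (by
        rw [Set.disjoint_singleton_right, ensemblePast, Set.mem_iUnion]
        rintro ⟨n', h | ⟨i, hi, h | h⟩⟩
        · simp at h
        · simp at h; omega
        · simp at h)
      ((R.sources_enkfMember H y j n subset_rfl).prodMk
        (R.sources_mfMember H y n j (Set.subset_iUnion (fun n => memberPast n j) _)))
      (R.sources_w rfl)
  have h := IndepFun.ae_prop (p := fun z : (Euc d × Euc d) × Ξ =>
      ‖D.step z.1.1 z.2 - D.step z.1.2 z.2‖ ≤ C * ‖z.1.1 - z.1.2‖)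
    ((R.measurable_enkfMember H y j n).prodMk (R.measurable_mfMember H y n j))
    (R.measurable_w (j + 1) n) hind ?_ ?_
  · exact h
  · have h1 : Measurable fun z : (Euc d × Euc d) × Ξ => D.step z.1.1 z.2 :=
      D.measurable_step.comp ((measurable_fst.comp measurable_fst).prodMk measurable_snd)
    have h2 : Measurable fun z : (Euc d × Euc d) × Ξ => D.step z.1.2 z.2 :=
      D.measurable_step.comp ((measurable_snd.comp measurable_fst).prodMk measurable_snd)
    exact measurableSet_le (h1.sub h2).norm (by fun_prop)
  · intro a
    rw [R.map_w]
    exact hLip a.1 a.2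

end Randomness

/-! ### Test functions, empirical measures and the distance -/

lemma enorm_sq_eq_ofReal (a : ℝ) : ‖a‖ₑ ^ 2 = ENNReal.ofReal (a ^ 2) := by
  rw [Real.enorm_eq_ofReal_abs, ← ENNReal.ofReal_pow (abs_nonneg a), sq_abs]

lemma integral_empirical {E : Type*} [MeasurableSpace E] {N : ℕ} (v : Fin N → E) {f : E → ℝ}
    (hf : StronglyMeasurable f) : ∫ x, f x ∂empirical v = avg fun n => f (v n) := by
  have hint : ∀ n ∈ (Finset.univ : Finset (Fin N)), Integrable f (Measure.dirac (v n)) :=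
    fun n _ => integrable_dirac' hf (by simp)
  rw [empirical, integral_smul_measure, integral_finsetSum_measure hint]
  simp only [integral_dirac' _ _ hf, avg]
  simp

lemma abs_le_one_of_blNorm_le {E : Type*} [PseudoEMetricSpace E] {f : E → ℝ} (hf : blNorm f ≤ 1)
    (x : E) : |f x| ≤ 1 := by
  have h : ‖f x‖ₑ ≤ 1 := (le_iSup (fun x => ‖f x‖ₑ) x).trans (le_self_add.trans hf)
  rw [Real.enorm_eq_ofReal_abs] at h
  simpa using h

lemma abs_sub_le_of_blNorm_le {d : ℕ} {f : Euc d → ℝ} (hf : blNorm f ≤ 1) (x x' : Euc d) :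
    |f x - f x'| ≤ ‖x - x'‖ := by
  by_cases hx : x = x'
  · simp [hx]
  have h : ‖f x - f x'‖ₑ / edist x x' ≤ 1 :=
    (le_iSup₂_of_le x x'
      (le_iSup (fun _ : x ≠ x' => ‖f x - f x'‖ₑ / edist x x') hx)).trans (le_add_self.trans hf)
  have h2 : ‖f x - f x'‖ₑ ≤ edist x x' := by
    rwa [ENNReal.div_le_iff (edist_pos.2 hx).ne' (edist_ne_top x x'), one_mul] at h
  rw [Real.enorm_eq_ofReal_abs, edist_dist, dist_eq_norm] at h2
  exact (ENNReal.ofReal_le_ofReal_iff (norm_nonneg _)).1 h2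

/-- The supremum in `rmsDist` runs over arbitrary functions; the Lipschitz part of the norm supplies
measurability. -/
lemma measurable_of_blNorm_le {d : ℕ} {f : Euc d → ℝ} (hf : blNorm f ≤ 1) : Measurable f :=
  (LipschitzWith.of_dist_le_mul (K := 1) fun x x' => by
    simpa [Real.dist_eq, dist_eq_norm] using abs_sub_le_of_blNorm_le hf x x').continuous.measurable

/-- A mean square bound `c / N` with `c` independent of `f` survives the supremum; its square root
is `√c * N ^ (-1 / 2)`. -/
lemma rmsDist_le {Ω E : Type*} [MeasurableSpace Ω] [PseudoEMetricSpace E] [MeasurableSpace E]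
    {P : Measure Ω} {μ ν : Ω → Measure E} {c : ℝ} (hc : 0 ≤ c) {N : ℕ}
    (h : ∀ f : E → ℝ, blNorm f ≤ 1 →
      ∫⁻ ω, ‖(∫ x, f x ∂(μ ω)) - ∫ x, f x ∂(ν ω)‖ₑ ^ 2 ∂P ≤ ENNReal.ofReal (c / N)) :
    rmsDist P μ ν ≤ ENNReal.ofReal (Real.toNNReal √c * (N : ℝ) ^ (-(1 / 2) : ℝ)) := by
  refine iSup₂_le fun f hf => ?_
  refine (ENNReal.rpow_le_rpow (h f hf) (by norm_num)).trans_eq ?_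
  rw [ENNReal.ofReal_rpow_of_nonneg (by positivity) (by norm_num), ← Real.sqrt_eq_rpow,
    Real.sqrt_div hc, Real.coe_toNNReal _ (Real.sqrt_nonneg c), Real.rpow_neg (by positivity),
    ← Real.sqrt_eq_rpow, div_eq_mul_inv]

lemma measurable_avg {Ω : Type*} [MeasurableSpace Ω] {N : ℕ} {g : Fin N → Ω → ℝ}
    (hg : ∀ n, Measurable (g n)) : Measurable fun ω => avg fun n => g n ω := by
  unfold avg
  fun_prop

/-! ### The expected fluctuation is of order `1 / N` -/

namespace Randomness

variable {Ω : Type*} [MeasurableSpace Ω] {P : Measure Ω} {d m : ℕ} {ρ₀ : Measure (Euc d)}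
  {Ξ : Type*} [MeasurableSpace Ξ] {K : Kernel (Euc d) (Euc d)} {D : DrivingNoise K Ξ}
  {Γ : Matrix (Fin m) (Fin m) ℝ} (R : Randomness P ρ₀ D.law Γ) (H : Matrix (Fin m) (Fin d) ℝ)

/-- The fluctuation of the mean-field ensemble. -/
noncomputable def mfFluctuation (N : ℕ) (y : ℕ → Euc m) (j : ℕ) (ω : Ω) : ℝ :=
  fluctuation K D.step H Γ ρ₀ y (fun n : Fin N => R.v₀ n ω) (fun i n => R.w i n ω)
    (fun i n => R.ηt i n ω) j

lemma mfFluctuation_eq (N : ℕ) (y : ℕ → Euc m) (j : ℕ) (ω : Ω) :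
    R.mfFluctuation H N y j ω =
      ∑ i, (avg (fun n : Fin N => R.mfForecast H y n j ω i) -
          ∫ v, v i ∂forecastLaw K H Γ ρ₀ y j) ^ 2 +
        ∑ i, ∑ k, (avg (fun n : Fin N => R.mfForecast H y n j ω i * R.mfForecast H y n j ω k) -
          ∫ v, v i * v k ∂forecastLaw K H Γ ρ₀ y j) ^ 2 +
        (avg (fun n : Fin N => ‖R.ηt (j + 1) n ω‖ ^ 2) -
          ∫ z, ‖z‖ ^ 2 ∂multivariateGaussian (0 : Euc m) Γ) ^ 2 := rfl

lemma mfFluctuation_nonneg (N : ℕ) (y : ℕ → Euc m) (j : ℕ) (ω : Ω) :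
    0 ≤ R.mfFluctuation H N y j ω :=
  fluctuation_nonneg _ _ _ _ _ _ _ _ _ _

lemma measurable_mfFluctuation (N : ℕ) (y : ℕ → Euc m) (j : ℕ) :
    Measurable (R.mfFluctuation H N y j) := by
  have hF : ∀ n i, Measurable fun ω => R.mfForecast H y n j ω i := fun n i =>
    (measurable_apply i).comp (R.measurable_mfForecast H y n j)
  refine Measurable.add (Measurable.add ?_ ?_) ?_
  · exact Finset.measurable_fun_sum _ fun i _ =>
      ((measurable_avg fun n : Fin N => hF n i).sub_const _).pow_const 2
  · exact Finset.measurable_fun_sum _ fun i _ => Finset.measurable_fun_sum _ fun k _ =>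
      ((measurable_avg fun n : Fin N => (hF n i).mul (hF n k)).sub_const _).pow_const 2
  · exact ((measurable_avg fun n : Fin N =>
      (R.measurable_ηt (j + 1) n).norm.pow_const 2).sub_const _).pow_const 2

variable [IsProbabilityMeasure P] [IsMarkovKernel K] [IsProbabilityMeasure ρ₀]

/-- The fluctuation is a sum of `d + d ^ 2 + 1` squared Monte Carlo errors, for functions whose
squares are integrable thanks to the fourth moments. The constant adds up their second moments. -/
lemma lintegral_mfFluctuation_le {y : ℕ → Euc m} {j : ℕ} {M Mη : ℝ}
    (hM : FourthMoment (forecastLaw K H Γ ρ₀ y j) M)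
    (hη : FourthMoment (multivariateGaussian (0 : Euc m) Γ) Mη) {N : ℕ} (hN : 1 ≤ N) :
    ∫⁻ ω, ENNReal.ofReal (R.mfFluctuation H N y j ω) ∂P ≤
      ENNReal.ofReal ((d * (1 + M) + d * (d * (1 + M)) + Mη) / N) := by
  have hM0 := hM.nonneg
  have hMη0 := hη.nonneg
  have hNpos : (0 : ℝ) < N := by positivity
  have hF : ∀ n i, Measurable fun ω => R.mfForecast H y n j ω i := fun n i =>
    (measurable_apply i).comp (R.measurable_mfForecast H y n j)
  have m1 : ∀ i, Measurable fun ω => ENNReal.ofReal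
      ((avg (fun n : Fin N => R.mfForecast H y n j ω i) -
        ∫ v, v i ∂forecastLaw K H Γ ρ₀ y j) ^ 2) := fun i =>
    (((measurable_avg fun n : Fin N => hF n i).sub_const _).pow_const 2).ennreal_ofReal
  have m2 : ∀ i k, Measurable fun ω => ENNReal.ofReal
      ((avg (fun n : Fin N => R.mfForecast H y n j ω i * R.mfForecast H y n j ω k) -
        ∫ v, v i * v k ∂forecastLaw K H Γ ρ₀ y j) ^ 2) := fun i k =>
    (((measurable_avg fun n : Fin N => (hF n i).mul (hF n k)).sub_const _).pow_const 2).ennreal_ofReal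
  have hX := R.measurable_mfForecast H y (j := j)
  have hlaw : ∀ n, P.map (R.mfForecast H y n j) = forecastLaw K H Γ ρ₀ y j :=
    fun n => R.map_mfForecast H y n j
  have hind := R.indepFun_mfForecast H y j
  have b1 : ∀ i, ∫⁻ ω, ENNReal.ofReal ((avg (fun n : Fin N => R.mfForecast H y n j ω i) -
      ∫ v, v i ∂forecastLaw K H Γ ρ₀ y j) ^ 2) ∂P ≤ ENNReal.ofReal ((1 + M) / N) := fun i =>
    (lintegral_sq_avg_sub_le hX hlaw hind (measurable_apply i) (hM.memLp_apply i) hN).trans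
      (ENNReal.ofReal_le_ofReal (div_le_div_of_nonneg_right (hM.integral_sq_apply_le i) hNpos.le))
  have b2 : ∀ i k, ∫⁻ ω, ENNReal.ofReal
      ((avg (fun n : Fin N => R.mfForecast H y n j ω i * R.mfForecast H y n j ω k) -
      ∫ v, v i * v k ∂forecastLaw K H Γ ρ₀ y j) ^ 2) ∂P ≤ ENNReal.ofReal ((1 + M) / N) :=
    fun i k =>
    (lintegral_sq_avg_sub_le hX hlaw hind ((measurable_apply i).mul (measurable_apply k))
      (hM.memLp_mul i k) hN).trans
      (ENNReal.ofReal_le_ofReal (div_le_div_of_nonneg_right (hM.integral_sq_mul_le i k) hNpos.le))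
  have b3 : ∫⁻ ω, ENNReal.ofReal ((avg (fun n : Fin N => ‖R.ηt (j + 1) n ω‖ ^ 2) -
      ∫ z, ‖z‖ ^ 2 ∂multivariateGaussian (0 : Euc m) Γ) ^ 2) ∂P ≤ ENNReal.ofReal (Mη / N) := by
    have hsq : ∀ z : Euc m, (‖z‖ ^ 2) ^ 2 = ‖z‖ ^ 4 := fun z => by ring
    have hL : MemLp (fun z : Euc m => ‖z‖ ^ 2) 2 (multivariateGaussian (0 : Euc m) Γ) := by
      rw [memLp_two_iff_integrable_sq (by fun_prop)]
      simpa only [hsq] using hη.integrable_norm_pow_four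
    refine (lintegral_sq_avg_sub_le (g := fun z : Euc m => ‖z‖ ^ 2) (R.measurable_ηt (j + 1))
      (R.map_ηt (j + 1)) (R.indepFun_ηt (j + 1)) (by fun_prop) hL hN).trans
      (ENNReal.ofReal_le_ofReal (div_le_div_of_nonneg_right ?_ hNpos.le))
    simpa only [hsq] using hη.integral_le
  have hsum : ∀ ω, ENNReal.ofReal (R.mfFluctuation H N y j ω) =
      ∑ i, ENNReal.ofReal ((avg (fun n : Fin N => R.mfForecast H y n j ω i) -
          ∫ v, v i ∂forecastLaw K H Γ ρ₀ y j) ^ 2) +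
        ∑ i, ∑ k, ENNReal.ofReal
          ((avg (fun n : Fin N => R.mfForecast H y n j ω i * R.mfForecast H y n j ω k) -
          ∫ v, v i * v k ∂forecastLaw K H Γ ρ₀ y j) ^ 2) +
        ENNReal.ofReal ((avg (fun n : Fin N => ‖R.ηt (j + 1) n ω‖ ^ 2) -
          ∫ z, ‖z‖ ^ 2 ∂multivariateGaussian (0 : Euc m) Γ) ^ 2) := by
    intro ω
    have p1 := sum_sq_nonneg fun i => avg (fun n : Fin N => R.mfForecast H y n j ω i) -
          ∫ v, v i ∂forecastLaw K H Γ ρ₀ y j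
    have p2 : ∀ i, 0 ≤ ∑ k, (avg (fun n : Fin N =>
        R.mfForecast H y n j ω i * R.mfForecast H y n j ω k) -
          ∫ v, v i * v k ∂forecastLaw K H Γ ρ₀ y j) ^ 2 := fun i => sum_sq_nonneg _
    rw [mfFluctuation_eq, ENNReal.ofReal_add (add_nonneg p1 (Finset.sum_nonneg fun i _ => p2 i))
      (sq_nonneg _), ENNReal.ofReal_add p1 (Finset.sum_nonneg fun i _ => p2 i),
      ENNReal.ofReal_sum_of_nonneg fun i _ => sq_nonneg _,
      ENNReal.ofReal_sum_of_nonneg fun i _ => p2 i]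
    congr 2
    exact Finset.sum_congr rfl fun i _ => ENNReal.ofReal_sum_of_nonneg fun k _ => sq_nonneg _
  simp only [hsum]
  have mm : Measurable fun ω => ∑ i, ENNReal.ofReal
      ((avg (fun n : Fin N => R.mfForecast H y n j ω i) -
        ∫ v, v i ∂forecastLaw K H Γ ρ₀ y j) ^ 2) := Finset.measurable_fun_sum _ fun i _ => m1 i
  have mm2 : Measurable fun ω => ∑ i, ∑ k, ENNReal.ofReal
      ((avg (fun n : Fin N => R.mfForecast H y n j ω i * R.mfForecast H y n j ω k) -
        ∫ v, v i * v k ∂forecastLaw K H Γ ρ₀ y j) ^ 2) :=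
    Finset.measurable_fun_sum _ fun i _ => Finset.measurable_fun_sum _ fun k _ => m2 i k
  have mm3 : Measurable fun ω => ∑ i, ENNReal.ofReal
      ((avg (fun n : Fin N => R.mfForecast H y n j ω i) -
        ∫ v, v i ∂forecastLaw K H Γ ρ₀ y j) ^ 2) + ∑ i, ∑ k, ENNReal.ofReal
      ((avg (fun n : Fin N => R.mfForecast H y n j ω i * R.mfForecast H y n j ω k) -
        ∫ v, v i * v k ∂forecastLaw K H Γ ρ₀ y j) ^ 2) := mm.add mm2
  rw [lintegral_add_left mm3, lintegral_add_left mm,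
    lintegral_finsetSum _ fun i _ => m1 i,
    lintegral_finsetSum _ fun i _ => Finset.measurable_fun_sum _ fun k _ => m2 i k]
  have hq : 0 ≤ (1 + M) / N := by positivity
  have e : ENNReal.ofReal ((d * (1 + M) + d * (d * (1 + M)) + Mη) / N) =
      ∑ _i : Fin d, ENNReal.ofReal ((1 + M) / N) +
        ∑ _i : Fin d, ∑ _k : Fin d, ENNReal.ofReal ((1 + M) / N) + ENNReal.ofReal (Mη / N) := by
    simp only [Finset.sum_const, Finset.card_univ, Fintype.card_fin, nsmul_eq_mul,
      ← ENNReal.ofReal_natCast]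
    rw [← ENNReal.ofReal_mul (by positivity), ← ENNReal.ofReal_mul (by positivity),
      ← ENNReal.ofReal_add (by positivity) (by positivity),
      ← ENNReal.ofReal_add (by positivity) (by positivity)]
    congr 1
    ring
  rw [e]
  refine add_le_add (add_le_add (Finset.sum_le_sum fun i _ => b1 i)
    (Finset.sum_le_sum fun i _ => ?_)) b3
  rw [lintegral_finsetSum _ fun k _ => m2 i k]
  exact Finset.sum_le_sum fun k _ => b2 i k

end Randomness

/-! ### From the coupling to bounded Lipschitz test functions -/

lemma measurable_prod_pi {α A B C : Type*} [MeasurableSpace α] [MeasurableSpace A]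
    [MeasurableSpace B] [MeasurableSpace C] {a : ℕ → α → A} {b : ℕ → ℕ → α → B}
    {c : ℕ → ℕ → α → C} (ha : ∀ n, Measurable (a n)) (hb : ∀ i n, Measurable (b i n))
    (hc : ∀ i n, Measurable (c i n)) :
    Measurable fun x => ((fun n => a n x, fun i n => b i n x, fun i n => c i n x) :
      (ℕ → A) × (ℕ → ℕ → B) × (ℕ → ℕ → C)) :=
  (measurable_pi_lambda _ ha).prodMk
    ((measurable_pi_lambda _ fun i => measurable_pi_lambda _ (hb i)).prodMk
      (measurable_pi_lambda _ fun i => measurable_pi_lambda _ (hc i)))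

/-- Distance between two ensembles, tested against a bounded Lipschitz function. -/
lemma sq_avg_sub_le_of_blNorm_le {d N : ℕ} (hN : 1 ≤ N) {f : Euc d → ℝ} (hf : blNorm f ≤ 1)
    (v v' : Fin N → Euc d) {L e : ℝ} (hL : 0 ≤ L) (he : 0 ≤ e)
    (h : e ≤ 1 → avg (fun n => ‖v n - v' n‖ ^ 2) ≤ L * e) :
    (avg (fun n => f (v n)) - avg fun n => f (v' n)) ^ 2 ≤ (L + 4) * e := by
  rw [← avg_sub]
  refine (sq_avg_le hN _).trans ?_
  -- The pathwise estimate holds only for small fluctuation. Otherwise `|f| ≤ 1` bounds the squared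
  -- difference by `4`, which is less than `4 * e`.
  by_cases h1 : e ≤ 1
  · calc _ ≤ avg (fun n => ‖v n - v' n‖ ^ 2) := avg_mono fun n => by
          rw [← sq_abs]
          exact pow_le_pow_left₀ (abs_nonneg _) (abs_sub_le_of_blNorm_le hf _ _) 2
      _ ≤ L * e := h h1
      _ ≤ _ := by linarith
  · calc _ ≤ avg (fun _ : Fin N => (4 : ℝ)) := avg_mono fun n => by
          have a1 := abs_le.1 (abs_le_one_of_blNorm_le hf (v n))
          have a2 := abs_le.1 (abs_le_one_of_blNorm_le hf (v' n))
          nlinarith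
      _ = 4 := avg_const hN 4
      _ ≤ _ := by nlinarith

/-! ### Random data, and the mean square error of the EnKF -/

namespace Randomness

variable {Ω : Type*} [MeasurableSpace Ω] {P : Measure Ω} {d m : ℕ} {ρ₀ : Measure (Euc d)}
  {Ξ : Type*} [MeasurableSpace Ξ] {K : Kernel (Euc d) (Euc d)} {D : DrivingNoise K Ξ}
  {Γ : Matrix (Fin m) (Fin m) ℝ} (R : Randomness P ρ₀ D.law Γ) (H : Matrix (Fin m) (Fin d) ℝ)

lemma sources_signal (j : ℕ) {S : Set Source} (hS : signalPast j ⊆ S) :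
    Measurable[R.sources S] fun ω => signal D.step (R.u₀ ω) (fun i => R.ξ i ω) j := by
  induction j with
  | zero => exact R.sources_u₀ (hS (Or.inl rfl))
  | succ j ih =>
    refine D.measurable_step.comp (Measurable.prodMk (ih fun s hs => hS ?_)
      (R.sources_ξ (hS (Or.inr ⟨j + 1, le_rfl, rfl⟩))))
    rcases hs with rfl | ⟨i, hi, rfl⟩
    · exact Or.inl rfl
    · exact Or.inr ⟨i, by omega, rfl⟩

lemma measurable_signal (j : ℕ) :
    Measurable fun ω => signal D.step (R.u₀ ω) (fun i => R.ξ i ω) j :=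
  (R.sources_signal j subset_rfl).mono (R.sources_le _) le_rfl

lemma measurable_observe : Measurable fun p : Euc d × Euc m => observe H p.1 p.2 := by
  have h : Continuous fun u : Euc d => WithLp.toLp 2 (H *ᵥ u.ofLp) := by fun_prop
  exact (h.measurable.comp measurable_fst).add measurable_snd

lemma sources_data : Measurable[R.sources signalSources] (R.data D.step H) := by
  have hS : ∀ j, signalPast j ⊆ signalSources := by
    rintro j s (rfl | ⟨i, -, rfl⟩)
    · exact Or.inl rfl
    · exact Or.inr ⟨i, Or.inl rfl⟩
  have h : ∀ j, Measurable[R.sources signalSources] fun ω => R.data D.step H ω j := fun j =>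
    (measurable_observe H).comp
      (g := fun p : Euc d × Euc m => observe H p.1 p.2)
      (f := fun ω => (signal D.step (R.u₀ ω) (fun i => R.ξ i ω) j, R.η j ω))
      ((R.sources_signal j (hS j)).prodMk (R.sources_η (Or.inr ⟨j, Or.inr rfl⟩)))
  exact @measurable_pi_lambda Ω ℕ (fun _ => Euc m) (R.sources signalSources) _ _ h

/-- The inputs of the ensembles. -/
def inputs (ω : Ω) : (ℕ → Euc d) × (ℕ → ℕ → Ξ) × (ℕ → ℕ → Euc m) :=
  (fun n => R.v₀ n ω, fun i n => R.w i n ω, fun i n => R.ηt i n ω)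

/-- The labels of signal and observations are disjoint from those of the ensemble at every step. -/
lemma indepFun_data_inputs : IndepFun (R.data D.step H) R.inputs P := by
  refine R.indepFun_of_disjoint (S := signalSources) (T := ⋃ j, ensemblePast j)
    (Set.disjoint_iUnion_right.2 disjoint_signalSources_ensemblePast) (R.sources_data H) ?_
  have hmem : ∀ {s : Source} (n j : ℕ), s ∈ memberPast n j → s ∈ ⋃ j, ensemblePast j :=
    fun n j hs => Set.mem_iUnion.2 ⟨j, Set.mem_iUnion.2 ⟨n, hs⟩⟩
  exact @measurable_prod_pi Ω _ _ _ (R.sources (⋃ j, ensemblePast j)) _ _ _ R.v₀ R.w R.ηt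
    (fun n => R.sources_v₀ (hmem n 0 (Or.inl rfl)))
    (fun i n => R.sources_w (hmem n i (Or.inr ⟨i, le_rfl, Or.inl rfl⟩)))
    (fun i n => R.sources_ηt (hmem n i (Or.inr ⟨i, le_rfl, Or.inr rfl⟩)))

lemma measurable_data : Measurable (R.data D.step H) :=
  (R.sources_data H).mono (R.sources_le _) le_rfl

lemma measurable_inputs : Measurable R.inputs :=
  measurable_prod_pi R.measurable_v₀ R.measurable_w R.measurable_ηt

variable [IsProbabilityMeasure P]

/-- Each new noise is independent of the current signal, so the law advances by `K` and the moment
growth hypothesis iterates. -/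
lemma lintegral_signal_lt_top {p : ℝ}
    (hMom : ∃ C' : ℝ≥0, ∀ μ : Measure (Euc d), IsProbabilityMeasure μ →
      ∫⁻ u, ‖u‖ₑ ^ p ∂μ < ∞ →
      ∫⁻ v, ‖v‖ₑ ^ p ∂(μ.bind K) ≤ C' * (1 + ∫⁻ u, ‖u‖ₑ ^ p ∂μ))
    (hρ₀ : ∫⁻ u, ‖u‖ₑ ^ p ∂ρ₀ < ∞) (j : ℕ) :
    ∫⁻ u, ‖u‖ₑ ^ p ∂(P.map fun ω => signal D.step (R.u₀ ω) (fun i => R.ξ i ω) j) < ∞ := by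
  induction j with
  | zero => simpa only [signal, R.map_u₀] using hρ₀
  | succ j ih =>
    obtain ⟨C', hC'⟩ := hMom
    have hind : IndepFun (fun ω => signal D.step (R.u₀ ω) (fun i => R.ξ i ω) j) (R.ξ (j + 1)) P :=
      R.indepFun_of_disjoint (S := signalPast j) (T := {Source.signalNoise (j + 1)})
        (by
          rw [Set.disjoint_singleton_right]
          rintro (h | ⟨i, hi, h⟩) <;> simp at h
          omega)
        (R.sources_signal j subset_rfl) (R.sources_ξ rfl)
    have h := D.map_step_eq_bind (R.measurable_signal j) (R.measurable_ξ (j + 1))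
      (R.map_ξ (j + 1)) hind
    have hp := Measure.isProbabilityMeasure_map (μ := P) (R.measurable_signal j).aemeasurable
    simp only [signal]
    rw [h]
    refine (hC' _ hp ih).trans_lt ?_
    exact ENNReal.mul_lt_top ENNReal.coe_lt_top (ENNReal.add_lt_top.2 ⟨ENNReal.one_lt_top, ih⟩)

open scoped Matrix.Norms.L2Operator in
-- All orders are needed because the growth degree of the error constant is not bounded in advance;
-- elsewhere the fourth moment suffices.
lemma memLp_data
    (hMom : ∀ p : ℝ, 2 ≤ p → ∃ C' : ℝ≥0, ∀ μ : Measure (Euc d), IsProbabilityMeasure μ →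
      ∫⁻ u, ‖u‖ₑ ^ p ∂μ < ∞ →
      ∫⁻ v, ‖v‖ₑ ^ p ∂(μ.bind K) ≤ C' * (1 + ∫⁻ u, ‖u‖ₑ ^ p ∂μ))
    (hρ₀ : ∀ p : ℝ, 2 ≤ p → ∫⁻ u, ‖u‖ₑ ^ p ∂ρ₀ < ∞) (j : ℕ) (p : ℝ≥0∞) (hp : p ≠ ∞) :
    MemLp (fun ω => R.data D.step H ω j) p P := by
  -- The moment hypotheses start at exponent two; smaller exponents follow since `P` is a
  -- probability measure.
  have hq2 : 2 ≤ (max p 2).toReal := by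
    have := ENNReal.toReal_mono (by simp [hp]) (le_max_right p 2)
    simpa using this
  have hqtop : max p 2 ≠ ∞ := by simp [hp]
  have hu : MemLp (fun ω => signal D.step (R.u₀ ω) (fun i => R.ξ i ω) j) p P := by
    refine MemLp.mono_exponent (p := p) (q := max p 2) ?_ (le_max_left _ _)
    refine ⟨(R.measurable_signal j).aestronglyMeasurable, ?_⟩
    rw [eLpNorm_lt_top_iff_lintegral_rpow_enorm_lt_top (by simp) hqtop]
    have h := R.lintegral_signal_lt_top (hMom _ hq2) (hρ₀ _ hq2) j
    rwa [lintegral_map (by fun_prop) (R.measurable_signal j)] at h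
  have hη : MemLp (R.η j) p P := by
    have h : MemLp (id : Euc m → Euc m) p (P.map (R.η j)) := by
      rw [R.map_η]; exact IsGaussian.memLp_id _ p hp
    exact (memLp_map_measure_iff h.1 (R.measurable_η j).aemeasurable).1 h
  have hcont : Continuous fun u : Euc d => WithLp.toLp 2 (H *ᵥ u.ofLp) := by fun_prop
  have hHu : MemLp (fun ω => WithLp.toLp 2
      (H *ᵥ (signal D.step (R.u₀ ω) (fun i => R.ξ i ω) j).ofLp)) p P :=
    MemLp.of_le_mul hu (hcont.measurable.comp (R.measurable_signal j)).aestronglyMeasurable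
      (ae_of_all _ fun ω => norm_toLp_mulVec_le H _)
  exact hHu.add hη

variable [IsMarkovKernel K] [IsProbabilityMeasure ρ₀]

/-- The mean square error of the EnKF for a fixed realization of the data. -/
lemma exists_lintegral_sq_enkf_sub_le (hΓ : Γ.PosDef)
    (hLip : ∃ C : ℝ, ∀ a b : Euc d, ∀ᵐ ξ ∂D.law, ‖D.step a ξ - D.step b ξ‖ ≤ C * ‖a - b‖)
    (hMom : ∃ C' : ℝ≥0, ∀ μ : Measure (Euc d), IsProbabilityMeasure μ →
      ∫⁻ u, ‖u‖ₑ ^ (4 : ℝ) ∂μ < ∞ →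
      ∫⁻ v, ‖v‖ₑ ^ (4 : ℝ) ∂(μ.bind K) ≤ C' * (1 + ∫⁻ u, ‖u‖ₑ ^ (4 : ℝ) ∂μ))
    (hρ₀ : ∫⁻ u, ‖u‖ₑ ^ (4 : ℝ) ∂ρ₀ < ∞) (j : ℕ) :
    ∃ c : (ℕ → Euc m) → ℝ, PolyBdd c ∧ (∀ y, 0 ≤ c y) ∧
      ∀ (y : ℕ → Euc m) (N : ℕ) (_ : 1 ≤ N) (f : Euc d → ℝ) (_ : blNorm f ≤ 1),
        ∫⁻ ω, ‖(∫ x, f x ∂(R.enkf D.step H N y j ω)) - ∫ x, f x ∂(meanField K H Γ ρ₀ y j)‖ₑ ^ 2 ∂P ≤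
          ENNReal.ofReal (c y / N) := by
  obtain ⟨C, hC⟩ := hLip
  obtain ⟨L, hL, hL0, hpath⟩ :=
    exists_avg_sq_norm_ensemble_sub_member_le K D.step H Γ ρ₀ hΓ hMom hρ₀ C j
  obtain ⟨Mη, hη⟩ := exists_fourthMoment_gaussian Γ
  choose M g hM _ hb using fun i => exists_fourthMoment_forecast (K := K) H ρ₀ hΓ hMom hρ₀ i
  have hM0 : ∀ i y, 0 ≤ M i y := fun i y => (hb i y).1.nonneg
  have hMη := hη.nonneg
  set b : ℕ → (ℕ → Euc m) → ℝ :=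
    fun i y => d * (1 + M i y) + d * (d * (1 + M i y)) + Mη with hbdef
  have hb0 : ∀ i y, 0 ≤ b i y := fun i y => by have := hM0 i y; positivity
  have hbp : ∀ i, PolyBdd (b i) := fun i => by
    have h1 : PolyBdd fun y => d * (1 + M i y) :=
      (PolyBdd.const (d : ℝ)).mul ((PolyBdd.const 1).add (hM i))
    exact (h1.add ((PolyBdd.const (d : ℝ)).mul h1)).add (PolyBdd.const Mη)
  have hsum : ∀ n, PolyBdd fun y => ∑ i ∈ Finset.range n, b i y := by
    intro n
    induction n with
    | zero => simpa using PolyBdd.const 0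
    | succ n ih => simpa only [Finset.sum_range_succ] using ih.add (hbp n)
  -- The factors `2` come from squaring a sum of two errors: the coupling error, with factor `L + 4`
  -- per unit of fluctuation, and the Monte Carlo error, with constant `1 ≥ ∫ f ^ 2`.
  refine ⟨fun y => 2 * (L y + 4) * (∑ i ∈ Finset.range j, b i y) + 2 * 1,
    ((((PolyBdd.const 2).mul (hL.add (PolyBdd.const 4)))).mul (hsum j)).add
      (PolyBdd.const (2 * 1)), fun y => ?_, ?_⟩
  · have := hL0 y
    have := Finset.sum_nonneg fun i (_ : i ∈ Finset.range j) => hb0 i y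
    positivity
  intro y N hN f hf
  have hLy := hL0 y
  have hfm := measurable_of_blNorm_le hf
  have hNpos : (0 : ℝ) < N := by positivity
  set π := meanField K H Γ ρ₀ y j with hπ
  have hprob : IsProbabilityMeasure π := isProbabilityMeasure_meanField K H Γ ρ₀ y j
  have hfL : MemLp f 2 π := MemLp.of_bound hfm.aestronglyMeasurable 1
    (ae_of_all _ fun x => abs_le_one_of_blNorm_le hf x)
  have hf2 : ∫ x, f x ^ 2 ∂π ≤ 1 := by
    calc _ ≤ ∫ _, (1 : ℝ) ∂π := integral_mono hfL.integrable_sq (integrable_const 1) fun x =>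
          (sq_le_one_iff_abs_le_one _).2 (abs_le_one_of_blNorm_le hf x)
      _ = 1 := by simp
  have hae : ∀ᵐ ω ∂P,
      ‖(∫ x, f x ∂(R.enkf D.step H N y j ω)) - ∫ x, f x ∂π‖ₑ ^ 2 ≤
        ENNReal.ofReal (2 * (L y + 4)) *
            ∑ i ∈ Finset.range j, ENNReal.ofReal (R.mfFluctuation H N y i ω) +
          ENNReal.ofReal 2 * ENNReal.ofReal
            ((avg (fun n : Fin N => f (R.mfMember H y n j ω)) - ∫ x, f x ∂π) ^ 2) := by
    filter_upwards [R.ae_norm_step_sub_le H hC y N] with ω hω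
    have hp := hpath y N hN (fun n => R.v₀ n ω) (fun i n => R.w i n ω) (fun i n => R.ηt i n ω) hω
    have he0 : 0 ≤ ∑ i ∈ Finset.range j, R.mfFluctuation H N y i ω :=
      Finset.sum_nonneg fun i _ => R.mfFluctuation_nonneg H N y i ω
    have hd := sq_avg_sub_le_of_blNorm_le hN hf (R.enkfMember H N y j ω)
      (fun n => R.mfMember H y n j ω) hLy he0 hp
    rw [enkf, integral_empirical _ hfm.stronglyMeasurable, enorm_sq_eq_ofReal,
      ← ENNReal.ofReal_sum_of_nonneg fun i _ => R.mfFluctuation_nonneg H N y i ω,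
      ← ENNReal.ofReal_mul (by positivity), ← ENNReal.ofReal_mul (by positivity),
      ← ENNReal.ofReal_add (by positivity) (by positivity)]
    refine ENNReal.ofReal_le_ofReal ?_
    change (avg (fun n => f (R.enkfMember H N y j ω n)) - ∫ x, f x ∂π) ^ 2 ≤ _
    generalize avg (fun n => f (R.enkfMember H N y j ω n)) = p at *
    generalize avg (fun n : Fin N => f (R.mfMember H y n j ω)) = q at *
    have := add_sq_le (a := p - q) (b := q - ∫ x, f x ∂π)
    rw [sub_add_sub_cancel] at this
    linarith
  have mF : ∀ i, Measurable fun ω => ENNReal.ofReal (R.mfFluctuation H N y i ω) :=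
    fun i => (R.measurable_mfFluctuation H N y i).ennreal_ofReal
  have mS : Measurable fun ω =>
      ∑ i ∈ Finset.range j, ENNReal.ofReal (R.mfFluctuation H N y i ω) :=
    Finset.measurable_fun_sum _ fun i _ => mF i
  have hMC := lintegral_sq_avg_sub_le (fun n => R.measurable_mfMember H y n j)
    (fun n => R.map_mfMember H y n j) (R.indepFun_mfMember H y j) hfm hfL hN
  refine (lintegral_mono_ae hae).trans ?_
  rw [lintegral_add_left (mS.const_mul _), lintegral_const_mul _ mS,
    lintegral_const_mul' _ _ ENNReal.ofReal_ne_top, lintegral_finsetSum _ fun i _ => mF i]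
  have e : ENNReal.ofReal ((2 * (L y + 4) * (∑ i ∈ Finset.range j, b i y) + 2 * 1) / N) =
      ENNReal.ofReal (2 * (L y + 4)) * ∑ i ∈ Finset.range j, ENNReal.ofReal (b i y / N) +
        ENNReal.ofReal 2 * ENNReal.ofReal (1 / N) := by
    have hs : 0 ≤ ∑ i ∈ Finset.range j, b i y / N :=
      Finset.sum_nonneg fun i _ => div_nonneg (hb0 i y) hNpos.le
    rw [← ENNReal.ofReal_sum_of_nonneg fun i _ => div_nonneg (hb0 i y) hNpos.le,
      ← ENNReal.ofReal_mul (by positivity), ← ENNReal.ofReal_mul (by positivity),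
      ← ENNReal.ofReal_add (by positivity) (by positivity), ← Finset.sum_div]
    congr 1
    ring
  simp only [e]
  refine add_le_add (mul_le_mul_right (Finset.sum_le_sum fun i _ => ?_) _)
    (mul_le_mul_right (hMC.trans (ENNReal.ofReal_le_ofReal ?_)) _)
  · exact R.lintegral_mfFluctuation_le H (hb i y).1 hη hN
  · exact div_le_div_of_nonneg_right hf2 hNpos.le

/-- The mean square error for random data is the average over the data of the mean square error
for fixed data. -/
lemma lintegral_sq_enkf_data (N j : ℕ) {f : Euc d → ℝ} (hf : Measurable f) :
    ∫⁻ ω, ‖(∫ x, f x ∂(R.enkf D.step H N (R.data D.step H ω) j ω)) -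
        ∫ x, f x ∂(meanField K H Γ ρ₀ (R.data D.step H ω) j)‖ₑ ^ 2 ∂P =
      ∫⁻ ω, ∫⁻ ω', ‖(∫ x, f x ∂(R.enkf D.step H N (R.data D.step H ω) j ω')) -
        ∫ x, f x ∂(meanField K H Γ ρ₀ (R.data D.step H ω) j)‖ₑ ^ 2 ∂P ∂P := by
  let κ : Kernel (ℕ → Euc m) (Euc d) :=
    ⟨fun y => meanField K H Γ ρ₀ y j, measurable_meanField K H Γ ρ₀ j⟩
  have hκ : IsMarkovKernel κ := ⟨fun y => isProbabilityMeasure_meanField K H Γ ρ₀ y j⟩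
  have hmf : Measurable fun y => ∫ x, f x ∂(meanField K H Γ ρ₀ y j) :=
    (StronglyMeasurable.integral_kernel_prod_right (κ := κ) (f := fun _ x => f x)
      (hf.comp measurable_snd).stronglyMeasurable).measurable
  -- The squared error is a jointly measurable function of the data and the ensemble inputs. These
  -- are independent, so Tonelli applies to the product of their laws.
  let G : (ℕ → Euc m) × ((ℕ → Euc d) × (ℕ → ℕ → Ξ) × (ℕ → ℕ → Euc m)) → ℝ≥0∞ := fun p =>
    ‖avg (fun n : Fin N => f (ensemble D.step H Γ p.1 (fun n : Fin N => p.2.1 n)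
      (fun i n => p.2.2.1 i n) (fun i n => p.2.2.2 i n) j n)) -
        ∫ x, f x ∂(meanField K H Γ ρ₀ p.1 j)‖ₑ ^ 2
  have hG : Measurable G := by
    refine Measurable.pow_const (Measurable.enorm (Measurable.sub ?_ (hmf.comp measurable_fst))) 2
    refine measurable_avg fun n => hf.comp (measurable_ensemble D.measurable_step H Γ j ?_ ?_ ?_ ?_ n)
    all_goals intros; fun_prop
  have hGeq : ∀ (y : ℕ → Euc m) (ω : Ω), ‖(∫ x, f x ∂(R.enkf D.step H N y j ω)) -
        ∫ x, f x ∂(meanField K H Γ ρ₀ y j)‖ₑ ^ 2 = G (y, R.inputs ω) := by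
    intro y ω
    rw [enkf, integral_empirical _ hf.stronglyMeasurable]
    rfl
  simp only [hGeq]
  have hY := R.measurable_data H
  have hZ := R.measurable_inputs
  have hpZ : IsProbabilityMeasure (P.map R.inputs) :=
    Measure.isProbabilityMeasure_map hZ.aemeasurable
  rw [← lintegral_map (f := G) (g := fun ω => (R.data D.step H ω, R.inputs ω)) hG (hY.prodMk hZ),
    (indepFun_iff_map_prod_eq_prod_map_map hY.aemeasurable hZ.aemeasurable).1
      (R.indepFun_data_inputs H), lintegral_prod _ hG.aemeasurable,
    lintegral_map hG.lintegral_prod_right' hY]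
  refine lintegral_congr fun ω => ?_
  exact lintegral_map (f := fun z => G (R.data D.step H ω, z)) (hG.comp measurable_prodMk_left) hZ

end Randomness

end EnKF

/-! ### The two readings of the theorem -/

theorem theorem4p1 {d m : ℕ}
    -- the model: Markov kernel with a driving noise, linear observations, Gaussian noise
    (K : Kernel (EnKF.Euc d) (EnKF.Euc d)) [IsMarkovKernel K]
    {Ξ : Type*} [MeasurableSpace Ξ] (D : EnKF.DrivingNoise K Ξ)
    (H : Matrix (Fin m) (Fin d) ℝ) (Γ : Matrix (Fin m) (Fin m) ℝ) (hΓ : Γ.PosDef)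
    -- (i) Lipschitz dependence on the state for a shared realization of the noise
    (hLip : ∃ C : ℝ, ∀ a b : EnKF.Euc d, ∀ᵐ ξ ∂D.law, ‖D.step a ξ - D.step b ξ‖ ≤ C * ‖a - b‖)
    -- (ii) growth of moments, for states `u` of arbitrary law `μ` with a finite `p`-th moment
    (hMom : ∀ p : ℝ, 2 ≤ p → ∃ C' : ℝ≥0, ∀ μ : Measure (EnKF.Euc d), IsProbabilityMeasure μ →
      ∫⁻ u, ‖u‖ₑ ^ p ∂μ < ∞ →
      ∫⁻ v, ‖v‖ₑ ^ p ∂(μ.bind K) ≤ C' * (1 + ∫⁻ u, ‖u‖ₑ ^ p ∂μ))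
    -- the initial law has finite moments of all orders
    (ρ₀ : Measure (EnKF.Euc d)) [IsProbabilityMeasure ρ₀]
    (hρ₀ : ∀ p : ℝ, 2 ≤ p → ∫⁻ u, ‖u‖ₑ ^ p ∂ρ₀ < ∞)
    -- the random inputs of the signal, of the observations and of the ensembles
    {Ω : Type*} [MeasurableSpace Ω] (P : Measure Ω) [IsProbabilityMeasure P]
    (R : EnKF.Randomness P ρ₀ D.law Γ) (j : ℕ) :
    -- for random data generated by the model, the expectation being also over the data
    (∃ C : ℝ≥0, ∀ N : ℕ, 1 ≤ N →
      EnKF.rmsDist P (fun ω => R.enkf D.step H N (R.data D.step H ω) j ω)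
          (fun ω => EnKF.meanField K H Γ ρ₀ (R.data D.step H ω) j)
        ≤ ENNReal.ofReal (C * (N : ℝ) ^ (-(1 / 2) : ℝ))) ∧
    -- for every fixed realization `y` of the data
    (∀ y : ℕ → EnKF.Euc m, ∃ C : ℝ≥0, ∀ N : ℕ, 1 ≤ N →
      EnKF.rmsDist P (fun ω => R.enkf D.step H N y j ω) (fun _ => EnKF.meanField K H Γ ρ₀ y j)
        ≤ ENNReal.ofReal (C * (N : ℝ) ^ (-(1 / 2) : ℝ))) := by
  obtain ⟨c, hc, hc0, h⟩ := R.exists_lintegral_sq_enkf_sub_le H hΓ hLip (hMom 4 (by norm_num))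
    (hρ₀ 4 (by norm_num)) j
  refine ⟨?_, fun y => ⟨_, fun N hN => EnKF.rmsDist_le (hc0 y) fun f hf => h y N hN f hf⟩⟩
  -- For random data the constant is the average of `c` over the data, finite by polynomial growth
  -- and the moments of the data.
  set c' := ∫⁻ ω, ENNReal.ofReal (c (R.data D.step H ω)) ∂P with hc'
  have hfin : c' < ∞ := hc.lintegral_lt_top fun i p hp => R.memLp_data H hMom hρ₀ i p hp
  refine ⟨_, fun N hN => EnKF.rmsDist_le (c := c'.toReal) ENNReal.toReal_nonneg fun f hf => ?_⟩
  have hNpos : (0 : ℝ) < N := by positivity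
  rw [R.lintegral_sq_enkf_data H N j (EnKF.measurable_of_blNorm_le hf)]
  calc _ ≤ ∫⁻ ω, ENNReal.ofReal (c (R.data D.step H ω)) * ENNReal.ofReal (N : ℝ)⁻¹ ∂P := by
        refine lintegral_mono fun ω => (h _ N hN f hf).trans_eq ?_
        rw [div_eq_mul_inv, ENNReal.ofReal_mul (hc0 _)]
    -- Measurability of `c` is not known; the factor can be taken out because it is finite.
    _ = c' * ENNReal.ofReal (N : ℝ)⁻¹ := lintegral_mul_const' _ _ ENNReal.ofReal_ne_top
    _ = _ := by
        rw [div_eq_mul_inv, ENNReal.ofReal_mul ENNReal.toReal_nonneg,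
          ENNReal.ofReal_toReal hfin.ne]
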